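/- **Theorem 1.4.** For every constant $0<\varepsilon<1/3$ there are constants $c>0$ and $C\in\mathbb{N}$, depending only on $\varepsilon$, such that the following holds for all integers $n,k$ with $2/\varepsilon<k<n/2$, every set $V$ of $n$ points and every set $T\subseteq V$ of $k$ terminals. For a metric $w$ on $V$, let $\mathsf{ST}(V,T,w)$ be the metric Steiner Tree cost: the minimum, over all connected subgraphs of the complete graph on $V$ whose vertex set contains $T$, of the sum of $w(u,v)$ over the edges $\{u,v\}$ of the subgraph. Consider a randomized algorithm that knows $V$ and $T$, learns about $w$ only through adaptive queries (each query names a pair $u,v\in V$ and is answered by $w(u,v)$), always stops after finitely many queries, and outputs a real number $X$. Suppose that for every metric $w$ on $V$, with probability at least $2/3$ over its internal randomness, the algorithm estimates the cost to within a factor of $2-\varepsilon$, that is, $$\mathsf{ST}(V,T,w)\le X\le (2-\varepsilon)\cdot \mathsf{ST}(V,T,w).$$ Then in the worst case the algorithm performs at least $$c\cdot\frac{n+k^{6/5}}{(\log n)^{C}}=\tilde\Omega\big(n+k^{6/5}\big)$$ queries: there is a metric $w$ on $V$ on which, with positive probability over its internal randomness, it performs at least this many queries. -/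

import Mathlib

open MeasureTheory
open scoped ENNReal

namespace SteinerQuery

section

/-- The total weight of a subgraph `H` of the complete graph on `V`, every edge `{u, v}` having
weight `m.dist u v`. -/
noncomputable def weight {V : Type} [Fintype V] (m : MetricSpace V)
    (H : (⊤ : SimpleGraph V).Subgraph) : ℝ :=
  open Classical in
  ∑ e : Sym2 V with e ∈ H.edgeSet, Sym2.lift ⟨m.dist, m.dist_comm⟩ e

/-- `H` is a feasible solution: a connected subgraph containing all terminals. -/
def IsSteinerSubgraph {V : Type} (T : Finset V) (H : (⊤ : SimpleGraph V).Subgraph) : Prop :=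
  H.Connected ∧ ∀ t ∈ T, t ∈ H.verts

/-- The metric Steiner Tree cost: the minimum weight of a connected subgraph that contains all
terminals. There are finitely many subgraphs, so the infimum is a minimum. -/
noncomputable def steinerCost {V : Type} [Fintype V] (m : MetricSpace V) (T : Finset V) : ℝ :=
  sInf {c : ℝ | ∃ H : (⊤ : SimpleGraph V).Subgraph, IsSteinerSubgraph T H ∧ weight m H = c}

/-- A deterministic adaptive query algorithm: it either stops and outputs a real number, or queries
the distance of a pair of points and continues in a way that depends on the answer. -/
inductive QueryTree (V : Type) : Type
  | answer (x : ℝ) : QueryTree V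
  | query (u v : V) (next : ℝ → QueryTree V) : QueryTree V

/-- The output when queries are answered by `d`. -/
def QueryTree.output {V : Type} (d : V → V → ℝ) : QueryTree V → ℝ
  | .answer x => x
  | .query u v next => (next (d u v)).output d

/-- The number of queries performed when queries are answered by `d`. -/
def QueryTree.queries {V : Type} (d : V → V → ℝ) : QueryTree V → ℕ
  | .answer _ => 0
  | .query u v next => (next (d u v)).queries d + 1

/-- A randomized query algorithm with coin space `Ω`: each outcome of the coins determines a
deterministic query algorithm, and on each input metric the output is a random variable. -/
structure RandomizedAlgorithm (V : Type) (Ω : Type*) [MeasurableSpace Ω] where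
  /-- The deterministic algorithm that is run when the coins come up as `ω`. -/
  tree : Ω → QueryTree V
  measurable_output : ∀ m : MetricSpace V, Measurable fun ω => (tree ω).output m.dist

/-- On every metric, with probability at least `2/3` over the coins `μ`, the output `X` is an
`α`-estimation of the Steiner Tree cost with terminal set `T`, i.e. `ST ≤ X ≤ α · ST`. -/
def RandomizedAlgorithm.Estimates {V : Type} [Fintype V] {Ω : Type*} [MeasurableSpace Ω]
    (A : RandomizedAlgorithm V Ω) (μ : Measure Ω) (T : Finset V) (α : ℝ) : Prop :=
  ∀ m : MetricSpace V,
    (2 / 3 : ℝ≥0∞) ≤ μ {ω | steinerCost m T ≤ (A.tree ω).output m.dist ∧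
      (A.tree ω).output m.dist ≤ α * steinerCost m T}

end

end SteinerQuery

/-! Two bounds are proved separately and combined: one linear in `n`, and one of order `k ^ (6/5)`.
No logarithmic factor is lost.

Both come from Yao's principle in a two-family form (`exists_metric_of_indistinguishable`): metrics
are paired so that the costs in a pair differ by more than the approximation factor for most pairs,
and a deterministic algorithm making few queries accepts almost as often on one family as on the
other.

Linear bound: all distances are 2, or one hidden Steiner point has distance 1 to every terminal. The
costs are `2 * (k - 1)` and at most `k`, separated because `k > 2 / ε`. A run that never touches the
hidden point sees no difference.

Superlinear bound: terminals receive random labels, and terminals of one class almost coincide.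
There are `N` rare classes of one label each, and far fewer frequent classes of `W` labels each, so
rare classes decide the cost while most terminals are frequent. In the star family each Steiner
point is close to one random rare class, so connecting the classes costs about 2 per class. In the
group family the rare classes are split at random into `G` groups, with `G` much smaller than `N`,
and a `1 / Z` fraction of the Steiner points uses its class number as a group number instead. A
typical group then has a centre, and the cost falls to about 1 per class.

Given labels and groups, Steiner points are independent, and every informative answer about Steiner
data concerns one of them. Distinguishability is therefore controlled point by point
(`card_accept_sub_le`). By `card_consistent_le`, a point loses likelihood, by at most `1 / Z`, only
when it is `Suspicious`: a query found a terminal of its own class, and another compared it with a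
different rare class of the same group.

Suspicion is rare for two reasons. Rare terminals are hard to find: before `t` meets its own class,
its queries look as if it were isolated, and resampling its label shows that most effort goes to
frequent terminals (`sum_le_of_resample`). This bounds both the number of exposed rare terminals and
the queries at unexposed ones. Secondly, two fixed distinct rare classes share a group with
probability `1 / G`. `sum_card_suspicious_le` combines these facts, tail bounds handle atypical
inputs, and `exists_group_parameters` balances the errors for `y ^ 6` queries and at least `y ^ 5`
terminals. -/

namespace SteinerQuery

/-! ### Transcripts of query algorithms and truncation at one point. -/

namespace QueryTree

variable {V : Type}

/-- The list of pairs queried when queries are answered by `d`. -/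
def trace (d : V → V → ℝ) : QueryTree V → List (V × V)
  | .answer _ => []
  | .query u v next => (u, v) :: (next (d u v)).trace d

theorem length_trace (d : V → V → ℝ) (A : QueryTree V) : (A.trace d).length = A.queries d := by
  induction A with
  | answer x => rfl
  | query u v next ih => simp [trace, queries, ih]

theorem trace_congr {d d' : V → V → ℝ} (A : QueryTree V)
    (h : ∀ e ∈ A.trace d, d' e.1 e.2 = d e.1 e.2) : A.trace d' = A.trace d := by
  induction A with
  | answer x => rfl
  | query u v next ih =>
    have h0 : d' u v = d u v := h (u, v) (by simp [trace])
    simp only [trace, h0]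
    rw [ih (d u v) fun e he => h e (by simp [trace, he])]

theorem output_congr {d d' : V → V → ℝ} (A : QueryTree V)
    (h : ∀ e ∈ A.trace d, d' e.1 e.2 = d e.1 e.2) : A.output d' = A.output d := by
  induction A with
  | answer x => rfl
  | query u v next ih =>
    have h0 : d' u v = d u v := h (u, v) (by simp [trace])
    simp only [output, h0]
    rw [ih (d u v) fun e he => h e (by simp [trace, he])]

variable [DecidableEq V]

/-- The number of pairs of the list that contain `t`. -/
def touching (t : V) (l : List (V × V)) : ℕ := l.countP fun e => e.1 = t ∨ e.2 = t

theorem sum_touching_le (s : Finset V) (l : List (V × V)) :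
    ∑ t ∈ s, touching t l ≤ 2 * l.length := by
  induction l with
  | nil => simp [touching]
  | cons e l ih =>
    have h1 : ∀ t, touching t (e :: l) ≤
        touching t l + ((if e.1 = t then 1 else 0) + if e.2 = t then 1 else 0) := by
      intro t
      simp only [touching, List.countP_cons]
      split_ifs <;> simp_all
    have h2 : ∀ v : V, ∑ t ∈ s, (if v = t then 1 else 0) ≤ 1 := by
      intro v
      rw [Finset.sum_ite_eq]
      split_ifs <;> simp
    calc _ ≤ ∑ t ∈ s, (touching t l + ((if e.1 = t then 1 else 0) + if e.2 = t then 1 else 0)) :=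
          Finset.sum_le_sum fun t _ => h1 t
      _ ≤ 2 * l.length + (1 + 1) := by
          rw [Finset.sum_add_distrib, Finset.sum_add_distrib]
          exact add_le_add ih (add_le_add (h2 _) (h2 _))
      _ = _ := by simp [mul_add]

/-- The algorithm that stops instead of performing more than `h` queries at `t`. -/
def cut (t : V) : QueryTree V → ℕ → QueryTree V
  | .answer x, _ => .answer x
  | .query u v next, 0 =>
    -- The output 0 is arbitrary: only the transcript of the truncated algorithm is used.
    if u = t ∨ v = t then .answer 0 else .query u v fun x => (next x).cut t 0
  | .query u v next, h + 1 =>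
    if u = t ∨ v = t then .query u v fun x => (next x).cut t h
    else .query u v fun x => (next x).cut t (h + 1)

theorem touching_cut_le (t : V) (d : V → V → ℝ) (A : QueryTree V) (h : ℕ) :
    touching t ((A.cut t h).trace d) ≤ h := by
  induction A generalizing h with
  | answer x => simp [cut, trace, touching]
  | query u v next ih =>
    simp only [touching] at ih
    cases h with
    | zero =>
      by_cases huv : u = t ∨ v = t
      · simp [cut, huv, trace, touching]
      · simpa [cut, huv, trace, touching, List.countP_cons] using ih (d u v) 0
    | succ h =>
      by_cases huv : u = t ∨ v = t
      · simpa [cut, huv, trace, touching, List.countP_cons] using ih (d u v) h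
      · simpa [cut, huv, trace, touching, List.countP_cons] using ih (d u v) (h + 1)

theorem touching_cut_le_touching (t : V) (d : V → V → ℝ) (A : QueryTree V) (h : ℕ) :
    touching t ((A.cut t h).trace d) ≤ touching t (A.trace d) := by
  induction A generalizing h with
  | answer x => simp [cut, trace, touching]
  | query u v next ih =>
    simp only [touching] at ih
    cases h with
    | zero =>
      by_cases huv : u = t ∨ v = t
      · simp [cut, huv, trace, touching]
      · simpa [cut, huv, trace, touching, List.countP_cons] using ih (d u v) 0
    | succ h =>
      by_cases huv : u = t ∨ v = t
      · simpa [cut, huv, trace, touching, List.countP_cons] using ih (d u v) h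
      · simpa [cut, huv, trace, touching, List.countP_cons] using ih (d u v) (h + 1)

/-- An unspent budget means that the truncation never acted. The inequality is strict because a run
with exactly `h` queries at `t` may have been stopped. -/
theorem trace_cut_of_lt (t : V) (d : V → V → ℝ) (A : QueryTree V) (h : ℕ)
    (hlt : touching t ((A.cut t h).trace d) < h) : (A.cut t h).trace d = A.trace d := by
  induction A generalizing h with
  | answer x => simp [cut, trace]
  | query u v next ih =>
    cases h with
    | zero => simp at hlt
    | succ h =>
      simp only [touching] at ih
      by_cases huv : u = t ∨ v = t
      · simp only [cut, huv, if_true, trace, touching, List.countP_cons] at hlt ⊢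
        rw [ih (d u v) h (by simpa using hlt)]
      · simp only [cut, huv, if_false, trace, touching, List.countP_cons] at hlt ⊢
        rw [ih (d u v) (h + 1) (by simpa using hlt)]

end QueryTree

/-! ### Metrics defined by classes of terminals. -/

section LabelMetric

variable {V κ : Type}

open Classical in
/-- Terminals with equal labels have distance `δ`, a Steiner point has distance `1` to the terminals
whose label it is adjacent to, and all remaining distances are `2`. -/
noncomputable def labelDist (T : Finset V) (δ : ℝ) (c : V → κ) (A : V → κ → Prop) (u v : V) : ℝ :=
  if u = v then 0
  else if u ∈ T then
    if v ∈ T then if c u = c v then δ else 2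
    else if A v (c u) then 1 else 2
  else if v ∈ T then if A u (c v) then 1 else 2
  else 2

theorem labelDist_congr (T : Finset V) (δ : ℝ) {c c' : V → κ} {A A' : V → κ → Prop} {u v : V}
    (hu : c u = c' u) (hv : c v = c' v) (huv : A u (c v) ↔ A' u (c v))
    (hvu : A v (c u) ↔ A' v (c u)) : labelDist T δ c A u v = labelDist T δ c' A' u v := by
  unfold labelDist
  rw [← hu, ← hv, propext huv, propext hvu]

/-- `labelDist` as a metric. -/
@[reducible] noncomputable def labelMetric (T : Finset V) (δ : ℝ) (hδ : 0 < δ) (hδ1 : δ ≤ 1) (c : V → κ)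
    (A : V → κ → Prop) : MetricSpace V where
  dist := labelDist T δ c A
  dist_self u := by simp [labelDist]
  dist_comm u v := by
    unfold labelDist
    rcases eq_or_ne u v with rfl | h
    · rfl
    · simp only [h, h.symm, if_false]
      split_ifs <;> first | rfl | (exfalso; simp_all)
  -- Nonzero distances are `δ`, 1 or 2, so only a path with a `δ` edge could be too short. Distances
  -- between a terminal and a point outside its class depend only on that class, so such an edge
  -- never provides a shortcut.
  dist_triangle u v w := by
    unfold labelDist
    rcases eq_or_ne u v with rfl | huv
    · simp
    rcases eq_or_ne v w with rfl | hvw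
    · simp
    rcases eq_or_ne u w with rfl | huw
    · simp only [if_true, huv, huv.symm, if_false]
      split_ifs <;> linarith
    simp only [huv, hvw, huw, if_false]
    by_cases hu : u ∈ T <;> by_cases hv : v ∈ T <;> by_cases hw : w ∈ T <;>
      simp only [hu, hv, hw, if_true, if_false] <;> (try split_ifs) <;>
      first
      | linarith
      | (exfalso; simp_all)
  eq_of_dist_eq_zero {u v} h := by
    by_contra huv
    change labelDist T δ c A u v = 0 at h
    unfold labelDist at h
    simp only [huv, if_false] at h
    split_ifs at h <;> linarith

end LabelMetric

/-! ### Upper and lower bounds for the Steiner Tree cost. -/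

section Cost

variable {V : Type} [Fintype V]

theorem weight_nonneg (m : MetricSpace V) (H : (⊤ : SimpleGraph V).Subgraph) : 0 ≤ weight m H := by
  classical
  unfold weight
  refine Finset.sum_nonneg fun e _ => ?_
  induction e with
  | h u v => exact dist_nonneg

theorem steinerCost_le (m : MetricSpace V) (T : Finset V) (H : (⊤ : SimpleGraph V).Subgraph)
    (hH : IsSteinerSubgraph T H) : steinerCost m T ≤ weight m H :=
  csInf_le ⟨0, by rintro _ ⟨H', -, rfl⟩; exact weight_nonneg m H'⟩ ⟨H, hH, rfl⟩

/-- A rooted tree, given by a parent function, bounds the Steiner Tree cost from above. -/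
theorem steinerCost_le_sum_parent [DecidableEq V] (m : MetricSpace V) (T W : Finset V) (r : V)
    (hr : r ∈ W) (hT : T ⊆ W) (parent : V → V) (rank : V → ℕ)
    (hparent : ∀ v ∈ W, v ≠ r → parent v ∈ W)
    (hrank : ∀ v ∈ W, v ≠ r → rank (parent v) < rank v) :
    steinerCost m T ≤ ∑ v ∈ W.erase r, m.dist v (parent v) := by
  classical
  let H : (⊤ : SimpleGraph V).Subgraph :=
    { verts := W
      Adj := fun u v => (u ∈ W ∧ u ≠ r ∧ v = parent u) ∨ (v ∈ W ∧ v ≠ r ∧ u = parent v)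
      adj_sub := by
        rintro u v (⟨h1, h2, h3⟩ | ⟨h1, h2, h3⟩) <;> rw [SimpleGraph.top_adj] <;> rintro rfl
        · exact absurd (hrank u h1 h2) (by rw [← h3]; exact lt_irrefl _)
        · exact absurd (hrank u h1 h2) (by rw [← h3]; exact lt_irrefl _)
      edge_vert := by
        rintro u v (⟨h1, h2, h3⟩ | ⟨h1, h2, h3⟩)
        · exact h1
        · rw [h3]; exact hparent v h1 h2
      symm := by
        constructor
        rintro u v (h | h)
        · exact Or.inr h
        · exact Or.inl h }
  have hreach : ∀ N : ℕ, ∀ v : V, ∀ hv : v ∈ W, rank v ≤ N →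
      H.coe.Reachable ⟨v, hv⟩ ⟨r, hr⟩ := by
    intro N
    induction N with
    | zero =>
      intro v hv hN
      by_cases hvr : v = r
      · subst hvr; exact SimpleGraph.Reachable.refl _
      · have := hrank v hv hvr; omega
    | succ N ih =>
      intro v hv hN
      by_cases hvr : v = r
      · subst hvr; exact SimpleGraph.Reachable.refl _
      · have h1 := hrank v hv hvr
        have h2 := ih (parent v) (hparent v hv hvr) (by omega)
        refine SimpleGraph.Reachable.trans (SimpleGraph.Adj.reachable ?_) h2
        change H.Adj v (parent v)
        exact Or.inl ⟨hv, hvr, rfl⟩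
  have hconn : H.Connected := by
    rw [SimpleGraph.Subgraph.connected_iff]
    refine ⟨⟨fun u v => ?_⟩, ⟨r, hr⟩⟩
    exact (hreach _ u.1 u.2 le_rfl).trans (hreach _ v.1 v.2 le_rfl).symm
  refine (steinerCost_le m T H ⟨hconn, fun t ht => hT ht⟩).trans ?_
  have hnn : ∀ e : Sym2 V, 0 ≤ Sym2.lift ⟨m.dist, m.dist_comm⟩ e := by
    intro e
    induction e with
    | h u v => exact dist_nonneg
  have hsub : (Finset.univ.filter fun e : Sym2 V => e ∈ H.edgeSet) ⊆
      (W.erase r).image fun v => s(v, parent v) := by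
    intro e he
    induction e with
    | h u v =>
      simp only [Finset.mem_filter, Finset.mem_univ, true_and, SimpleGraph.Subgraph.mem_edgeSet] at he
      rw [Finset.mem_image]
      rcases he with ⟨h1, h2, h3⟩ | ⟨h1, h2, h3⟩
      · exact ⟨u, Finset.mem_erase.2 ⟨h2, h1⟩, by rw [h3]⟩
      · exact ⟨v, Finset.mem_erase.2 ⟨h2, h1⟩, by rw [h3]; exact Sym2.eq_swap⟩
  unfold weight
  refine (Finset.sum_le_sum_of_subset_of_nonneg (t := (W.erase r).image fun v => s(v, parent v)) ?_
    fun e _ _ => hnn e).trans ?_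
  · convert hsub
  · refine (Finset.sum_image_le_of_nonneg fun v _ => hnn _).trans ?_
    exact le_of_eq (Finset.sum_congr rfl fun v _ => rfl)

/-- If points in different classes have distance at least `w`, then spanning all classes of
terminals costs at least `w` for every class but one. -/
theorem le_steinerCost [Nonempty V] {κ : Type*} [DecidableEq κ] (m : MetricSpace V) (T : Finset V)
    (c : V → κ) (w : ℝ) (hw : 0 ≤ w) (hc : ∀ u v, c u ≠ c v → w ≤ m.dist u v) :
    w * ((T.image c).card - 1) ≤ steinerCost m T := by
  classical
  refine le_csInf ⟨_, ⊤, ⟨?_, fun t _ => trivial⟩, rfl⟩ ?_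
  · rw [SimpleGraph.Subgraph.connected_iff]
    refine ⟨⟨fun u v => ?_⟩, ⟨Classical.arbitrary V, trivial⟩⟩
    by_cases huv : u = v
    · rw [huv]
    · exact SimpleGraph.Adj.reachable (by
        change (⊤ : SimpleGraph V).Adj u v
        exact fun h => huv (Subtype.ext h))
  rintro _ ⟨H, ⟨hconn, hT⟩, rfl⟩
  -- Contract the classes met by `H`. The quotient `Q` is connected, so it has at least `R.card - 1`
  -- edges, and each comes from an edge of `H` between different classes, of weight at least `w`.
  let R : Finset κ := (Finset.univ.filter fun v => v ∈ H.verts).image c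
  let Q : SimpleGraph R := SimpleGraph.fromRel fun x y => ∃ u v, H.Adj u v ∧ c u = x ∧ c v = y
  have hmem : ∀ v ∈ H.verts, c v ∈ R := fun v hv =>
    Finset.mem_image_of_mem _ (by simpa using hv)
  have hQreach : ∀ u v : H.verts, H.coe.Reachable u v →
      Q.Reachable ⟨c u, hmem u u.2⟩ ⟨c v, hmem v v.2⟩ := by
    rintro u v ⟨p⟩
    induction p with
    | nil => exact SimpleGraph.Reachable.refl _
    | @cons a b d hab p ih =>
      refine SimpleGraph.Reachable.trans ?_ ih
      by_cases hcab : c a = c b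
      · simp only [hcab]; exact SimpleGraph.Reachable.refl _
      · refine SimpleGraph.Adj.reachable ?_
        rw [SimpleGraph.fromRel_adj]
        exact ⟨fun h => hcab (congrArg Subtype.val h), Or.inl ⟨a, b, hab, rfl, rfl⟩⟩
  rw [SimpleGraph.Subgraph.connected_iff] at hconn
  obtain ⟨⟨hpre⟩, ⟨v0, hv0⟩⟩ := hconn
  have hQ : Q.Connected := by
    rw [SimpleGraph.connected_iff]
    refine ⟨?_, ⟨⟨c v0, hmem v0 hv0⟩⟩⟩
    rintro ⟨x, hx⟩ ⟨y, hy⟩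
    obtain ⟨u, hu, rfl⟩ := Finset.mem_image.1 hx
    obtain ⟨v, hv, rfl⟩ := Finset.mem_image.1 hy
    simp only [Finset.mem_filter, Finset.mem_univ, true_and] at hu hv
    exact hQreach ⟨u, hu⟩ ⟨v, hv⟩ (hpre _ _)
  have hcard := hQ.card_vert_le_card_edgeSet_add_one
  rw [Nat.card_eq_fintype_card, Fintype.card_coe] at hcard
  let E : Finset (Sym2 V) := Finset.univ.filter fun e => e ∈ H.edgeSet ∧ w ≤ Sym2.lift ⟨m.dist, m.dist_comm⟩ e
  have hE : Nat.card Q.edgeSet ≤ E.card := by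
    rw [← Nat.card_image_of_injective (Sym2.map.injective Subtype.val_injective) Q.edgeSet]
    have hsub : Sym2.map Subtype.val '' Q.edgeSet ⊆ ((E.image (Sym2.map c) : Finset (Sym2 κ)) : Set (Sym2 κ)) := by
      rintro _ ⟨e, he, rfl⟩
      induction e with
      | h x y =>
        rw [SimpleGraph.mem_edgeSet, SimpleGraph.fromRel_adj] at he
        obtain ⟨hne, h⟩ := he
        have hne' : (x : κ) ≠ y := fun h => hne (Subtype.ext h)
        rw [Finset.mem_coe, Finset.mem_image]
        rcases h with ⟨u, v, huv, hu, hv⟩ | ⟨u, v, huv, hu, hv⟩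
        · refine ⟨s(u, v), ?_, by simp [hu, hv]⟩
          simp only [E, Finset.mem_filter, Finset.mem_univ, true_and]
          exact ⟨huv, hc u v (by rw [hu, hv]; exact hne')⟩
        · refine ⟨s(u, v), ?_, by simp [hu, hv, Sym2.eq_swap]⟩
          simp only [E, Finset.mem_filter, Finset.mem_univ, true_and]
          exact ⟨huv, hc u v (by rw [hu, hv]; exact hne'.symm)⟩
    calc _ ≤ Nat.card ((E.image (Sym2.map c) : Finset (Sym2 κ)) : Set (Sym2 κ)) :=
          Nat.card_mono (Finset.finite_toSet _) hsub
      _ = (E.image (Sym2.map c)).card := by simp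
      _ ≤ _ := Finset.card_image_le
  have hTR : T.image c ⊆ R := by
    intro x hx
    obtain ⟨t, ht, rfl⟩ := Finset.mem_image.1 hx
    exact hmem t (hT t ht)
  have h2 : ((T.image c).card : ℝ) - 1 ≤ E.card := by
    have := Finset.card_le_card hTR
    have h3 : (T.image c).card ≤ E.card + 1 := by omega
    have : ((T.image c).card : ℝ) ≤ E.card + 1 := by exact_mod_cast h3
    linarith
  calc w * ((T.image c).card - 1) ≤ w * E.card := mul_le_mul_of_nonneg_left h2 hw
    _ = ∑ e ∈ E, w := by simp [mul_comm]
    _ ≤ ∑ e ∈ E, Sym2.lift ⟨m.dist, m.dist_comm⟩ e :=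
        Finset.sum_le_sum fun e he => (Finset.mem_filter.1 he).2.2
    _ ≤ weight m H := by
        unfold weight
        refine Finset.sum_le_sum_of_subset_of_nonneg ?_ ?_
        · intro e he
          have := (Finset.mem_filter.1 he).2.1
          simpa using this
        · intro e _ _
          induction e with
          | h u v => exact dist_nonneg

end Cost

/-! ### Yao's principle for two families. -/

section Minimax

variable {V : Type} [Fintype V] {Ω : Type*} [MeasurableSpace Ω]

open Classical in
/-- The easy direction of Yao's principle for distinguishing two families of metrics whose costs
are separated by the thresholds `θ`. -/
theorem exists_metric_of_indistinguishable (μ : Measure Ω) [IsProbabilityMeasure μ]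
    (A : RandomizedAlgorithm V Ω) (T : Finset V) (α : ℝ) (hA : A.Estimates μ T α)
    {σ : Type*} [Fintype σ] (mN mY : σ → MetricSpace V) (θ : σ → ℝ)
    (hN : ∀ i, θ i ≤ steinerCost (mN i) T) (bad : Finset σ)
    (hY : ∀ i ∉ bad, α * steinerCost (mY i) T < θ i) (Q γ : ℝ)
    (hind : ∀ B : QueryTree V, (∀ i, (B.queries (mN i).dist : ℝ) < Q) →
      ((Finset.univ.filter fun i => θ i ≤ B.output (mN i).dist).card : ℝ) -
        (Finset.univ.filter fun i => θ i ≤ B.output (mY i).dist).card ≤ γ)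
    (hγ : bad.card + γ < (Fintype.card σ : ℝ) / 3) :
    ∃ m : MetricSpace V, 0 < μ {ω | Q ≤ ((A.tree ω).queries m.dist : ℝ)} := by
  by_contra! hcon
  have hae : ∀ᵐ ω ∂μ, ∀ i, ((A.tree ω).queries (mN i).dist : ℝ) < Q := by
    rw [ae_all_iff]
    intro i
    have h0 := le_antisymm (hcon (mN i)) bot_le
    rw [ae_iff]
    simpa using h0
  let acc : MetricSpace V → σ → Set Ω := fun m i => {ω | θ i ≤ (A.tree ω).output m.dist}
  have hacc : ∀ m i, MeasurableSet (acc m i) := fun m i =>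
    measurableSet_le measurable_const (A.measurable_output m)
  -- For fixed coins, `F` is the difference between the numbers of accepted instances in the two
  -- families, where accepting means an output of at least `θ i`. Correctness makes its mean at
  -- least a third of the pairs minus the bad ones, whereas indistinguishability bounds it by `γ`
  -- almost surely.
  let F : Ω → ℝ := fun ω => ∑ i, ((acc (mN i) i).indicator (fun _ => (1 : ℝ)) ω -
    (acc (mY i) i).indicator (fun _ => (1 : ℝ)) ω)
  have hint : ∀ m i, Integrable ((acc m i).indicator (fun _ => (1 : ℝ))) μ := fun m i =>
    (integrable_const 1).indicator (hacc m i)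
  have hF : ∫ ω, F ω ∂μ = ∑ i, (μ.real (acc (mN i) i) - μ.real (acc (mY i) i)) := by
    simp only [F]
    rw [integral_finsetSum _ fun i _ => by exact (hint _ i).sub (hint _ i)]
    refine Finset.sum_congr rfl fun i _ => ?_
    rw [integral_sub (hint _ i) (hint _ i), integral_indicator_const _ (hacc _ i),
      integral_indicator_const _ (hacc _ i)]
    simp
  have hFle : ∀ᵐ ω ∂μ, F ω ≤ γ := by
    filter_upwards [hae] with ω hω
    have := hind (A.tree ω) hω
    refine le_trans (le_of_eq ?_) this
    simp only [F, acc, Finset.sum_sub_distrib, Set.indicator_apply, Set.mem_ofPred_eq,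
      Finset.sum_boole]
  have hFint : Integrable F μ := integrable_finsetSum _ fun i _ => (hint _ i).sub (hint _ i)
  have hup : ∫ ω, F ω ∂μ ≤ γ := by
    have := integral_mono_ae hFint (integrable_const γ) hFle
    simpa using this
  have hm : ∀ m : MetricSpace V, 2 / 3 ≤ μ.real {ω | steinerCost m T ≤ (A.tree ω).output m.dist ∧
      (A.tree ω).output m.dist ≤ α * steinerCost m T} := by
    intro m
    have h1 := ENNReal.toReal_mono (measure_ne_top _ _) (hA m)
    rw [ENNReal.toReal_div] at h1
    simpa [Measure.real] using h1
  have hlow : ∀ i, (1 / 3 : ℝ) - (if i ∈ bad then 1 else 0) ≤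
      μ.real (acc (mN i) i) - μ.real (acc (mY i) i) := by
    intro i
    have h1 : 2 / 3 ≤ μ.real (acc (mN i) i) :=
      (hm (mN i)).trans (measureReal_mono fun ω hω => (hN i).trans hω.1)
    by_cases hi : i ∈ bad
    · have : μ.real (acc (mY i) i) ≤ 1 := measureReal_le_one
      simp only [hi, if_true]
      linarith
    · have h2 : 2 / 3 ≤ μ.real (acc (mY i) i)ᶜ :=
        (hm (mY i)).trans (measureReal_mono fun ω hω => by
          simp only [acc, Set.mem_compl_iff, Set.mem_ofPred_eq, not_le]
          exact hω.2.trans_lt (hY i hi))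
      rw [probReal_compl_eq_one_sub (hacc _ i)] at h2
      simp only [hi, if_false]
      linarith
  have hsum := Finset.sum_le_sum fun i (_ : i ∈ Finset.univ) => hlow i
  rw [← hF, Finset.sum_sub_distrib, Finset.sum_boole] at hsum
  simp only [Finset.sum_const, Finset.card_univ, nsmul_eq_mul, Finset.filter_univ_mem] at hsum
  linarith

end Minimax

/-! ### The linear bound: a hidden hub. -/

section Linear

variable {V : Type} [Fintype V] [DecidableEq V] {Ω : Type*} [MeasurableSpace Ω]

/-- Each query touches at most two points. Fewer than `Tᶜ.card / 12` queries thus leave all but a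
sixth of the candidate hubs untouched, and for these the output equals that on the metric without a
hub. The third required by Yao's principle is not reached. -/
theorem linear_lower_bound (μ : Measure Ω) [IsProbabilityMeasure μ]
    (A : RandomizedAlgorithm V Ω) (T : Finset V) (α : ℝ) (hα : 0 ≤ α)
    (hT : α * T.card < 2 * (T.card - 1)) (hS : Tᶜ.Nonempty) (hA : A.Estimates μ T α) :
    ∃ m : MetricSpace V, 0 < μ {ω | (Tᶜ.card : ℝ) / 12 ≤ ((A.tree ω).queries m.dist : ℝ)} := by
  classical
  let mN : MetricSpace V := labelMetric T 1 one_pos le_rfl id fun _ _ => False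
  let mY : V → MetricSpace V := fun s => labelMetric T 1 one_pos le_rfl id fun s' _ => s' = s
  have hdN : mN.dist = labelDist T 1 id fun _ _ => False := rfl
  have hdY : ∀ s, (mY s).dist = labelDist T 1 id fun s' _ => s' = s := fun s => rfl
  obtain ⟨s0, hs0⟩ := hS
  have : Nonempty V := ⟨s0⟩
  have hcard : (0 : ℝ) < Tᶜ.card := by exact_mod_cast Finset.card_pos.2 ⟨s0, hs0⟩
  refine exists_metric_of_indistinguishable μ A T α hA (σ := (Tᶜ : Finset V)) (fun _ => mN)
    (fun s => mY s) (fun _ => 2 * (T.card - 1)) ?_ ∅ ?_ _ ((Tᶜ.card : ℝ) / 6) ?_ ?_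
  · intro _
    have := le_steinerCost mN T id 2 zero_le_two (fun u v huv => by
      have huv : u ≠ v := huv
      rw [hdN]
      simp [labelDist, huv])
    simpa using this
  · rintro ⟨s, hs⟩ -
    rw [Finset.mem_compl] at hs
    refine lt_of_le_of_lt (mul_le_mul_of_nonneg_left ?_ hα) hT
    refine (steinerCost_le_sum_parent (mY s) T (insert s T) s (Finset.mem_insert_self _ _)
      (Finset.subset_insert _ _) (fun _ => s) (fun v => if v = s then 0 else 1)
      (fun _ _ _ => Finset.mem_insert_self _ _) (fun v _ hv => by simp [hv])).trans ?_
    rw [Finset.erase_insert hs]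
    refine le_of_eq ?_
    rw [Finset.sum_congr rfl (g := fun _ => (1 : ℝ))]
    · simp
    · intro t ht
      have : t ≠ s := fun h => hs (h ▸ ht)
      rw [hdY]
      simp [labelDist, this, ht, hs]
  · intro B hB
    have hB := hB ⟨s0, hs0⟩
    let l := B.trace mN.dist
    let touched : Finset (Tᶜ : Finset V) :=
      Finset.univ.filter fun s => 1 ≤ QueryTree.touching (s : V) l
    have hsame : ∀ s ∉ touched, B.output (mY s).dist = B.output mN.dist := by
      intro s hs
      refine B.output_congr fun e he => ?_
      have hs : QueryTree.touching (s : V) l = 0 := by simpa [touched] using hs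
      have := List.countP_eq_zero.1 hs e he
      simp only [decide_eq_true_eq, not_or] at this
      rw [hdN, hdY]
      simp [labelDist, this.1, this.2]
    have hsub : (Finset.univ.filter fun _ : (Tᶜ : Finset V) => 2 * ((T.card : ℝ) - 1) ≤
        B.output mN.dist) ⊆ (Finset.univ.filter fun s : (Tᶜ : Finset V) =>
          2 * ((T.card : ℝ) - 1) ≤ B.output (mY s).dist) ∪ touched := by
      intro s hs
      rw [Finset.mem_union]
      by_cases h : s ∈ touched
      · exact Or.inr h
      · refine Or.inl ?_
        simp only [Finset.mem_filter, Finset.mem_univ, true_and] at hs ⊢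
        rwa [hsame s h]
    have hcardle := (Finset.card_le_card hsub).trans (Finset.card_union_le _ _)
    have htouched : touched.card ≤ 2 * B.queries mN.dist := by
      rw [← B.length_trace]
      calc touched.card = ∑ s ∈ touched, 1 := by simp
        _ ≤ ∑ s ∈ touched, QueryTree.touching (s : V) l :=
            Finset.sum_le_sum fun s hs => (Finset.mem_filter.1 hs).2
        _ ≤ ∑ s : (Tᶜ : Finset V), QueryTree.touching (s : V) l :=
            Finset.sum_le_sum_of_subset (Finset.subset_univ _)
        _ = ∑ s ∈ Tᶜ, QueryTree.touching s l :=
            Finset.sum_coe_sort Tᶜ fun s => QueryTree.touching s l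
        _ ≤ _ := QueryTree.sum_touching_le _ _
    have h1 : ((Finset.univ.filter fun _ : (Tᶜ : Finset V) => 2 * ((T.card : ℝ) - 1) ≤
        B.output mN.dist).card : ℝ) ≤ (Finset.univ.filter fun s : (Tᶜ : Finset V) =>
          2 * ((T.card : ℝ) - 1) ≤ B.output (mY s).dist).card + touched.card := by
      exact_mod_cast hcardle
    have h2 : (touched.card : ℝ) ≤ 2 * B.queries mN.dist := by exact_mod_cast htouched
    linarith
  · rw [Fintype.card_coe]
    simp only [Finset.card_empty, Nat.cast_zero]
    linarith

end Linear

/-! ### Likelihood ratios of transcripts for independent coordinates. -/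

section Product

theorem one_sub_sum_le_prod {ι : Type*} (s : Finset ι) (b : ι → ℝ) (h0 : ∀ i, 0 ≤ b i)
    (h1 : ∀ i, b i ≤ 1) : 1 - ∑ i ∈ s, b i ≤ ∏ i ∈ s, (1 - b i) := by
  classical
  induction s using Finset.induction_on with
  | empty => simp
  | insert a s ha ih =>
    rw [Finset.sum_insert ha, Finset.prod_insert ha]
    have hs : 0 ≤ ∑ i ∈ s, b i := Finset.sum_nonneg fun i _ => h0 i
    nlinarith [mul_le_mul_of_nonneg_left ih (sub_nonneg.2 (h1 a)), mul_nonneg (h0 a) hs]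

variable {V ι Λ : Type} [Fintype ι] [DecidableEq ι] [Fintype Λ]

open Classical in
/-- Two oracles whose answer to a query depends only on the coordinate of `f` that owns the query
are hard to distinguish if, for each coordinate, every list of answers of the first oracle is almost
as likely for the second one. -/
theorem card_accept_sub_le (B : QueryTree V) (owner : V → V → ι) (φ ψ : V → V → Λ → ℝ)
    (acc : ℝ → Prop) (b : (ι → Λ) → ι → ℝ) (hb0 : ∀ f i, 0 ≤ b f i) (hb1 : ∀ f i, b f i ≤ 1)
    (hb : ∀ f i, (1 - b f i) * (Finset.univ.filter fun x : Λ =>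
        ∀ e ∈ B.trace (fun u v => φ u v (f (owner u v))), owner e.1 e.2 = i →
          φ e.1 e.2 x = φ e.1 e.2 (f i)).card ≤
      (Finset.univ.filter fun x : Λ =>
        ∀ e ∈ B.trace (fun u v => φ u v (f (owner u v))), owner e.1 e.2 = i →
          ψ e.1 e.2 x = φ e.1 e.2 (f i)).card) :
    ((Finset.univ.filter fun f : ι → Λ =>
        acc (B.output fun u v => φ u v (f (owner u v)))).card : ℝ) -
      (Finset.univ.filter fun f : ι → Λ =>
        acc (B.output fun u v => ψ u v (f (owner u v)))).card ≤
      ∑ f : ι → Λ, min 1 (∑ i, b f i) := by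
  set dN : (ι → Λ) → V → V → ℝ := fun f u v => φ u v (f (owner u v)) with hdN
  set dY : (ι → Λ) → V → V → ℝ := fun f u v => ψ u v (f (owner u v)) with hdY
  -- `cN f` and `cY f` are the inputs on which the first and second oracle reproduce the transcript
  -- of `f`. Each answer constrains a single coordinate, so both are product sets and their size
  -- ratio is a product of coordinatewise ratios.
  let cN : (ι → Λ) → Finset (ι → Λ) := fun f =>
    Finset.univ.filter fun g => ∀ e ∈ B.trace (dN f), dN g e.1 e.2 = dN f e.1 e.2
  let cY : (ι → Λ) → Finset (ι → Λ) := fun f =>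
    Finset.univ.filter fun g => ∀ e ∈ B.trace (dN f), dY g e.1 e.2 = dN f e.1 e.2
  have hcNpi : ∀ f, cN f = Fintype.piFinset fun i => Finset.univ.filter fun x : Λ =>
      ∀ e ∈ B.trace (dN f), owner e.1 e.2 = i → φ e.1 e.2 x = φ e.1 e.2 (f i) := by
    intro f
    ext g
    simp only [cN, Finset.mem_filter, Finset.mem_univ, true_and, Fintype.mem_piFinset]
    constructor
    · rintro h i e he rfl
      exact h e he
    · intro h e he
      exact h _ e he rfl
  have hcYpi : ∀ f, cY f = Fintype.piFinset fun i => Finset.univ.filter fun x : Λ =>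
      ∀ e ∈ B.trace (dN f), owner e.1 e.2 = i → ψ e.1 e.2 x = φ e.1 e.2 (f i) := by
    intro f
    ext g
    simp only [cY, Finset.mem_filter, Finset.mem_univ, true_and, Fintype.mem_piFinset]
    constructor
    · rintro h i e he rfl
      exact h e he
    · intro h e he
      exact h _ e he rfl
  have hself : ∀ f, f ∈ cN f := fun f => by simp [cN]
  have hpos : ∀ f, (0 : ℝ) < (cN f).card := fun f => by
    exact_mod_cast Finset.card_pos.2 ⟨f, hself f⟩
  have hratio : ∀ f, (1 - min 1 (∑ i, b f i)) ≤ ((cY f).card : ℝ) / (cN f).card := by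
    intro f
    rw [le_div_iff₀ (hpos f)]
    rcases le_total 1 (∑ i, b f i) with h | h
    · rw [min_eq_left h]
      simp
    · rw [min_eq_right h]
      have h1 : (1 - ∑ i, b f i) * ((cN f).card : ℝ) ≤ (∏ i, (1 - b f i)) * (cN f).card :=
        mul_le_mul_of_nonneg_right (one_sub_sum_le_prod _ _ (hb0 f) (hb1 f)) (hpos f).le
      refine h1.trans ?_
      rw [hcNpi, hcYpi, Fintype.card_piFinset, Fintype.card_piFinset, Nat.cast_prod, Nat.cast_prod,
        ← Finset.prod_mul_distrib]
      exact Finset.prod_le_prod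
        (fun i _ => mul_nonneg (sub_nonneg.2 (hb1 f i)) (Nat.cast_nonneg _)) fun i _ => hb f i
  have htr : ∀ f g, g ∈ cY f → B.trace (dY g) = B.trace (dN f) := fun f g hg =>
    B.trace_congr fun e he => (Finset.mem_filter.1 hg).2 e he
  have hout : ∀ f g, g ∈ cY f → B.output (dY g) = B.output (dN f) := fun f g hg =>
    B.output_congr fun e he => (Finset.mem_filter.1 hg).2 e he
  have htrN : ∀ f g, g ∈ cN f → B.trace (dN g) = B.trace (dN f) := fun f g hg =>
    B.trace_congr fun e he => (Finset.mem_filter.1 hg).2 e he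
  have hcNeq : ∀ f g, g ∈ cN f → cN g = cN f := by
    intro f g hg
    ext x
    have hg' := (Finset.mem_filter.1 hg).2
    simp only [cN, Finset.mem_filter, Finset.mem_univ, true_and]
    rw [htrN f g hg]
    exact forall₂_congr fun e he => by rw [hg' e he]
  have hcommon : ∀ f f' g, g ∈ cY f → g ∈ cY f' → f' ∈ cN f := by
    intro f f' g hg hg'
    refine Finset.mem_filter.2 ⟨Finset.mem_univ _, fun e he => ?_⟩
    rw [← (Finset.mem_filter.1 hg).2 e he]
    refine ((Finset.mem_filter.1 hg').2 e ?_).symm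
    rwa [← htr f' g hg', htr f g hg]
  set SN := Finset.univ.filter fun f : ι → Λ => acc (B.output (dN f)) with hSN
  set SY := Finset.univ.filter fun f : ι → Λ => acc (B.output (dY f)) with hSY
  -- Each input `g` of the second oracle reproduces only one transcript, so the `f` with `g ∈ cY f`
  -- lie in one set `cN f0`. Giving each such `f` weight `1 / (cN f).card` charges `g` at most 1 in
  -- total.
  have hcount : ∑ f ∈ SN, ((cY f).card : ℝ) / (cN f).card ≤ SY.card := by
    have h1 : ∑ f ∈ SN, ((cY f).card : ℝ) / (cN f).card =
        ∑ f ∈ SN, ∑ g ∈ SY, if g ∈ cY f then 1 / ((cN f).card : ℝ) else 0 := by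
      refine Finset.sum_congr rfl fun f hf => ?_
      rw [← Finset.sum_filter, Finset.sum_const, nsmul_eq_mul, mul_one_div]
      congr 3
      ext g
      simp only [Finset.mem_filter, hSY, Finset.mem_univ, true_and]
      refine ⟨fun hg => ⟨?_, hg⟩, fun hg => hg.2⟩
      rw [hout f g hg]
      exact (Finset.mem_filter.1 hf).2
    rw [h1, Finset.sum_comm]
    calc _ ≤ ∑ g ∈ SY, (1 : ℝ) := Finset.sum_le_sum fun g _ => ?_
      _ = _ := by simp
    rw [← Finset.sum_filter]
    by_cases hne : ∃ f0, g ∈ cY f0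
    · obtain ⟨f0, hf0⟩ := hne
      calc _ ≤ ∑ f ∈ cN f0, 1 / ((cN f).card : ℝ) := by
            refine Finset.sum_le_sum_of_subset_of_nonneg ?_ fun f _ _ => by positivity
            intro f hf
            exact hcommon f0 f g hf0 (Finset.mem_filter.1 hf).2
        _ = ∑ f ∈ cN f0, 1 / ((cN f0).card : ℝ) :=
            Finset.sum_congr rfl fun f hf => by rw [hcNeq f0 f hf]
        _ = 1 := by
            rw [Finset.sum_const, nsmul_eq_mul, mul_one_div_cancel (hpos f0).ne']
        _ ≤ 1 := le_rfl
    · rw [Finset.filter_false_of_mem fun f _ hf => hne ⟨f, hf⟩]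
      simp
  have hlow : ∑ f ∈ SN, (1 - min 1 (∑ i, b f i)) ≤ SY.card :=
    (Finset.sum_le_sum fun f _ => hratio f).trans hcount
  rw [Finset.sum_sub_distrib, Finset.sum_const, nsmul_eq_mul, mul_one] at hlow
  have hle : ∑ f ∈ SN, min 1 (∑ i, b f i) ≤ ∑ f : ι → Λ, min 1 (∑ i, b f i) :=
    Finset.sum_le_sum_of_subset_of_nonneg (Finset.subset_univ _) fun f _ _ =>
      le_min zero_le_one (Finset.sum_nonneg fun i _ => hb0 f i)
  linarith

end Product

/-! ### Resampling one coordinate. -/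

section Resample

variable {V : Type} [Fintype V] [DecidableEq V] {L : Type} [Fintype L]

/-- Exchanging the stored value at `t` with the fresh value `y` is an involution on pairs, so
resampling preserves the uniform distribution. -/
theorem sum_sum_update (t : V) (F : (V → L) → ℝ) :
    ∑ l : V → L, ∑ y : L, F (Function.update l t y) = Fintype.card L * ∑ l, F l := by
  let e : (V → L) × L ≃ (V → L) × L :=
    { toFun := fun p => (Function.update p.1 t p.2, p.1 t)
      invFun := fun p => (Function.update p.1 t p.2, p.1 t)
      left_inv := fun p => by simp
      right_inv := fun p => by simp }
  calc _ = ∑ p : (V → L) × L, F (e p).1 := by rw [Fintype.sum_prod_type]; rfl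
    _ = ∑ p : (V → L) × L, F p.1 := Equiv.sum_comp e fun p => F p.1
    _ = _ := by
      rw [Fintype.sum_prod_type, Finset.mul_sum]
      simp

end Resample

/-! ### Random labels and the cost of exposing rare terminals. -/

section Labels

variable {V : Type} [DecidableEq V] {N M W : ℕ}

/-- The class of a label: labels on the left are rare, and those on the right come in `M` frequent
classes of `W` labels each. -/
def labelClass : Fin N ⊕ Fin M × Fin W → Fin N ⊕ Fin M := Sum.map id Prod.fst

/-- The metric in which every Steiner point is close to the terminals of just one rare class. -/
noncomputable def starDist (T : Finset V) (δ : ℝ) (l : V → Fin N ⊕ Fin M × Fin W) (a : V → Fin N) :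
    V → V → ℝ :=
  labelDist T δ (fun u => labelClass (l u)) fun s x => x = Sum.inl (a s)

/-- The class of a terminal is that of its label, the class of a Steiner point is the rare class that
it is close to. -/
def vertexClass (T : Finset V) (l : V → Fin N ⊕ Fin M × Fin W) (a : V → Fin N) (u : V) :
    Fin N ⊕ Fin M :=
  if u ∈ T then labelClass (l u) else Sum.inl (a u)

theorem starDist_eq_two (T : Finset V) (δ : ℝ) (l : V → Fin N ⊕ Fin M × Fin W) (a : V → Fin N)
    {u v : V} (h : vertexClass T l a u ≠ vertexClass T l a v) : starDist T δ l a u v = 2 := by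
  have huv : u ≠ v := fun e => h (by rw [e])
  unfold vertexClass at h
  unfold starDist labelDist
  by_cases hu : u ∈ T <;> by_cases hv : v ∈ T <;> simp_all [eq_comm]

theorem starDist_update (T : Finset V) (δ : ℝ) (l : V → Fin N ⊕ Fin M × Fin W) (a : V → Fin N)
    {t u v : V} (hu : u ≠ t) (hv : v ≠ t) (y) :
    starDist T δ (Function.update l t y) a u v = starDist T δ l a u v := by
  refine labelDist_congr T δ ?_ ?_ Iff.rfl Iff.rfl <;> simp [hu, hv]

theorem vertexClass_update (T : Finset V) (l : V → Fin N ⊕ Fin M × Fin W) (a : V → Fin N)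
    {t u : V} (hu : u ≠ t) (y) :
    vertexClass T (Function.update l t y) a u = vertexClass T l a u := by
  simp [vertexClass, hu]

/-- `starDist` with the point `t` moved away from all other points. -/
noncomputable def isolatedDist (T : Finset V) (δ : ℝ) (l : V → Fin N ⊕ Fin M × Fin W)
    (a : V → Fin N) (t u v : V) : ℝ :=
  if u = t ∨ v = t then if u = v then 0 else 2 else starDist T δ l a u v

theorem isolatedDist_update (T : Finset V) (δ : ℝ) (l : V → Fin N ⊕ Fin M × Fin W) (a : V → Fin N)
    (t : V) (y) : isolatedDist T δ (Function.update l t y) a t = isolatedDist T δ l a t := by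
  funext u v
  unfold isolatedDist
  by_cases h : u = t ∨ v = t
  · simp [h]
  · rw [if_neg h, if_neg h]
    rw [not_or] at h
    exact starDist_update T δ l a h.1 h.2 y

variable (B : QueryTree V) (T : Finset V) (δ : ℝ) (h : ℕ)

/-- The queries performed when `t` is isolated, up to the `h`-th query at `t`. -/
noncomputable def isolatedTrace (l : V → Fin N ⊕ Fin M × Fin W) (a : V → Fin N) (t : V) :
    List (V × V) :=
  (B.cut t h).trace (isolatedDist T δ l a t)

/-- Some query of `isolatedTrace` compares `t` with a point of class `x`. -/
def Hits (l : V → Fin N ⊕ Fin M × Fin W) (a : V → Fin N) (t : V) (x : Fin N ⊕ Fin M) : Prop :=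
  ∃ e ∈ isolatedTrace B T δ h l a t,
    (e.1 = t ∧ e.2 ≠ t ∧ vertexClass T l a e.2 = x) ∨
      (e.2 = t ∧ e.1 ≠ t ∧ vertexClass T l a e.1 = x)

/-- The algorithm may have learned something about the label of `t`. -/
def Exposed (l : V → Fin N ⊕ Fin M × Fin W) (a : V → Fin N) (t : V) : Prop :=
  h ≤ QueryTree.touching t (isolatedTrace B T δ h l a t) ∨
    Hits B T δ h l a t (labelClass (l t))

theorem isolatedTrace_update (l : V → Fin N ⊕ Fin M × Fin W) (a : V → Fin N) (t : V) (y) :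
    isolatedTrace B T δ h (Function.update l t y) a t = isolatedTrace B T δ h l a t := by
  rw [isolatedTrace, isolatedDist_update, isolatedTrace]

theorem hits_update (l : V → Fin N ⊕ Fin M × Fin W) (a : V → Fin N) (t : V) (y) (x) :
    Hits B T δ h (Function.update l t y) a t x ↔ Hits B T δ h l a t x := by
  unfold Hits
  rw [isolatedTrace_update]
  refine exists_congr fun e => and_congr_right fun _ => ?_
  refine or_congr ?_ ?_ <;> refine and_congr_right fun _ => and_congr_right fun he => ?_ <;>
    rw [vertexClass_update T l a he]

open Classical in
theorem card_hits_le (l : V → Fin N ⊕ Fin M × Fin W) (a : V → Fin N) (t : V) :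
    (Finset.univ.filter fun x => Hits B T δ h l a t x).card ≤
      QueryTree.touching t (isolatedTrace B T δ h l a t) := by
  let p : V × V → Bool := fun e => decide (e.1 = t ∨ e.2 = t)
  let c : V × V → Fin N ⊕ Fin M := fun e => vertexClass T l a (if e.1 = t then e.2 else e.1)
  have hsub : (Finset.univ.filter fun x => Hits B T δ h l a t x) ⊆
      (((isolatedTrace B T δ h l a t).filter p).map c).toFinset := by
    intro x hx
    obtain ⟨e, he, h1 | h1⟩ := (Finset.mem_filter.1 hx).2
    · simp only [List.mem_toFinset, List.mem_map, List.mem_filter]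
      exact ⟨e, ⟨he, by simp [p, h1.1]⟩, by simp [c, h1.1, h1.2.2]⟩
    · simp only [List.mem_toFinset, List.mem_map, List.mem_filter]
      exact ⟨e, ⟨he, by simp [p, h1.1]⟩, by simp [c, h1.2.1, h1.2.2]⟩
  refine (Finset.card_le_card hsub).trans ((List.toFinset_card_le _).trans ?_)
  rw [List.length_map, ← List.countP_eq_length_filter]
  exact le_rfl

/-- Points of different classes already have distance 2, so isolating `t` alters only its distances
to its own class. -/
theorem starDist_eq_isolatedDist {T : Finset V} {l : V → Fin N ⊕ Fin M × Fin W} {a : V → Fin N}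
    {t : V} (ht : t ∈ T) {e : V × V}
    (he : ∀ u, u ≠ t → (e = (t, u) ∨ e = (u, t)) → vertexClass T l a u ≠ labelClass (l t)) :
    starDist T δ l a e.1 e.2 = isolatedDist T δ l a t e.1 e.2 := by
  have hvt : vertexClass T l a t = labelClass (l t) := by simp [vertexClass, ht]
  obtain ⟨u, v⟩ := e
  unfold isolatedDist
  by_cases huv : u = v
  · subst huv
    simp [starDist, labelDist]
  by_cases hu : u = t
  · subst hu
    have := he v (Ne.symm huv) (Or.inl rfl)
    simp only [true_or, if_true, huv, if_false]
    exact starDist_eq_two T δ l a (by rw [hvt]; exact this.symm)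
  by_cases hv : v = t
  · subst hv
    have := he u huv (Or.inr rfl)
    simp only [or_true, if_true, huv, if_false]
    exact starDist_eq_two T δ l a (by rw [hvt]; exact this)
  · simp [hu, hv]

variable {B T δ h}

theorem starDist_eq_isolatedDist_of_not_hits {l : V → Fin N ⊕ Fin M × Fin W} {a : V → Fin N}
    {t : V} (ht : t ∈ T) (hh : ¬ Hits B T δ h l a t (labelClass (l t)))
    (e : V × V) (he : e ∈ isolatedTrace B T δ h l a t) :
    starDist T δ l a e.1 e.2 = isolatedDist T δ l a t e.1 e.2 := by
  refine starDist_eq_isolatedDist δ ht fun u hu heu hc => hh ?_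
  rcases heu with rfl | rfl
  · exact ⟨_, he, Or.inl ⟨rfl, hu, hc⟩⟩
  · exact ⟨_, he, Or.inr ⟨rfl, hu, hc⟩⟩

/-- Without a hit, the truncated runs on the true and on the isolated metric coincide, and
truncation only removes queries at `t`. -/
theorem touching_isolatedTrace_le {l : V → Fin N ⊕ Fin M × Fin W} {a : V → Fin N}
    {t : V} (ht : t ∈ T) (hh : ¬ Hits B T δ h l a t (labelClass (l t))) :
    QueryTree.touching t (isolatedTrace B T δ h l a t) ≤
      QueryTree.touching t (B.trace (starDist T δ l a)) := by
  have h1 : (B.cut t h).trace (starDist T δ l a) = isolatedTrace B T δ h l a t :=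
    (B.cut t h).trace_congr fun e he => starDist_eq_isolatedDist_of_not_hits ht hh e he
  rw [← h1]
  exact B.touching_cut_le_touching t _ h

/-- This makes the full transcript independent of the label of `t` as long as `t` stays unexposed,
since the isolated run does not see that label. -/
theorem isolatedTrace_eq_of_not_exposed {l : V → Fin N ⊕ Fin M × Fin W} {a : V → Fin N}
    {t : V} (ht : t ∈ T) (hh : ¬ Exposed B T δ h l a t) :
    B.trace (starDist T δ l a) = isolatedTrace B T δ h l a t := by
  rw [Exposed, not_or, not_le] at hh
  have h1 : isolatedTrace B T δ h l a t = B.trace (isolatedDist T δ l a t) :=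
    B.trace_cut_of_lt t _ h hh.1
  rw [h1]
  refine B.trace_congr fun e he => ?_
  exact starDist_eq_isolatedDist_of_not_hits ht hh.2 e (by rwa [h1])

/-- A terminal with a close query partner is exposed. -/
theorem exposed_of_mem_trace {l : V → Fin N ⊕ Fin M × Fin W} {a : V → Fin N} {t u : V}
    (ht : t ∈ T) (hu : u ≠ t) (hc : vertexClass T l a u = labelClass (l t))
    (he : (t, u) ∈ B.trace (starDist T δ l a) ∨ (u, t) ∈ B.trace (starDist T δ l a)) :
    Exposed B T δ h l a t := by
  by_contra hex
  rw [isolatedTrace_eq_of_not_exposed ht hex] at he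
  refine hex (Or.inr ?_)
  rcases he with he | he
  · exact ⟨_, he, Or.inl ⟨rfl, hu, hc⟩⟩
  · exact ⟨_, he, Or.inr ⟨rfl, hu, hc⟩⟩

variable (B T δ h)

/-- The isolated run hits at most `h ≤ M / 2` classes. At least half of the frequent classes are
therefore missed, and these hold at least a quarter of all labels because `N ≤ M * W`. For each such
label the real run makes at least as many queries at `t` as the isolated one. -/
theorem touching_isolatedTrace_mul_le (hM : 2 * h ≤ M) (hN : N ≤ M * W)
    (l : V → Fin N ⊕ Fin M × Fin W) (a : V → Fin N) {t : V} (ht : t ∈ T) :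
    (QueryTree.touching t (isolatedTrace B T δ h l a t) : ℝ) * ((N : ℝ) + M * W) ≤
      4 * ∑ y, (QueryTree.touching t (B.trace (starDist T δ (Function.update l t y) a)) : ℝ) := by
  classical
  set m := QueryTree.touching t (isolatedTrace B T δ h l a t) with hm
  have hmh : m ≤ h := QueryTree.touching_cut_le t _ B h
  let F : Finset (Fin M) := Finset.univ.filter fun b => Hits B T δ h l a t (Sum.inr b)
  have hF : F.card ≤ h := by
    refine le_trans ?_ ((card_hits_le B T δ h l a t).trans hmh)
    rw [← Finset.card_map (s := F) ⟨Sum.inr, Sum.inr_injective⟩]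
    refine Finset.card_le_card fun x hx => ?_
    obtain ⟨b, hb, rfl⟩ := Finset.mem_map.1 hx
    simpa [F] using hb
  have hle : ∀ b ∈ Fᶜ, ∀ w : Fin W, (m : ℝ) ≤ QueryTree.touching t
      (B.trace (starDist T δ (Function.update l t (Sum.inr (b, w))) a)) := by
    intro b hb w
    have := touching_isolatedTrace_le (B := B) (δ := δ) (h := h) (a := a)
      (l := Function.update l t (Sum.inr (b, w))) ht (by
        rw [hits_update]
        simpa [F, labelClass] using hb)
    rw [isolatedTrace_update, ← hm] at this
    exact_mod_cast this
  have h1 : (m : ℝ) * ((Fᶜ.card : ℝ) * W) ≤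
      ∑ y, (QueryTree.touching t (B.trace (starDist T δ (Function.update l t y) a)) : ℝ) := by
    rw [Fintype.sum_sum_type, Fintype.sum_prod_type]
    calc (m : ℝ) * ((Fᶜ.card : ℝ) * W) = ∑ b ∈ Fᶜ, ∑ w : Fin W, (m : ℝ) := by
          simp; ring
      _ ≤ ∑ b ∈ Fᶜ, ∑ w : Fin W, (QueryTree.touching t
          (B.trace (starDist T δ (Function.update l t (Sum.inr (b, w))) a)) : ℝ) :=
          Finset.sum_le_sum fun b hb => Finset.sum_le_sum fun w _ => hle b hb w
      _ ≤ ∑ b, ∑ w : Fin W, (QueryTree.touching t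
          (B.trace (starDist T δ (Function.update l t (Sum.inr (b, w))) a)) : ℝ) :=
          Finset.sum_le_sum_of_subset_of_nonneg (Finset.subset_univ _) fun _ _ _ =>
            Finset.sum_nonneg fun _ _ => Nat.cast_nonneg _
      _ ≤ _ := le_add_of_nonneg_left (Finset.sum_nonneg fun _ _ => Nat.cast_nonneg _)
  have h2 : (M : ℝ) ≤ 2 * Fᶜ.card := by
    have h3 := Finset.card_add_card_compl F
    rw [Fintype.card_fin] at h3
    have : M ≤ 2 * Fᶜ.card := by omega
    exact_mod_cast this
  have h4 : (N : ℝ) ≤ M * W := by exact_mod_cast hN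
  have h5 : (N : ℝ) + M * W ≤ 4 * (Fᶜ.card * W) := by
    nlinarith [mul_le_mul_of_nonneg_right h2 (Nat.cast_nonneg (α := ℝ) W)]
  calc (m : ℝ) * ((N : ℝ) + M * W) ≤ m * (4 * (Fᶜ.card * W)) :=
        mul_le_mul_of_nonneg_left h5 (Nat.cast_nonneg _)
    _ = 4 * (m * (Fᶜ.card * W)) := by ring
    _ ≤ _ := by linarith

-- With `m` queries at `t` in the isolated run, exhausting the budget exposes all `N` rare labels,
-- but then `m / h ≥ 1`. Otherwise only the hit classes are exposed, at most one per query.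
open Classical in
theorem sum_exposed_le_aux (hh : 0 < h) (l : V → Fin N ⊕ Fin M × Fin W) (a : V → Fin N) (t : V) :
    (∑ y : Fin N ⊕ Fin M × Fin W,
      if y.isLeft ∧ Exposed B T δ h (Function.update l t y) a t then (1 : ℝ) else 0) ≤
    ((N : ℝ) / h + 1) * QueryTree.touching t (isolatedTrace B T δ h l a t) := by
  set m := QueryTree.touching t (isolatedTrace B T δ h l a t) with hm
  have hh' : (0 : ℝ) < h := by exact_mod_cast hh
  have hcard := card_hits_le B T δ h l a t
  rw [← hm] at hcard
  rw [Fintype.sum_sum_type]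
  have hz : ∑ x : Fin M × Fin W, (if (Sum.inr x : Fin N ⊕ Fin M × Fin W).isLeft ∧
      Exposed B T δ h (Function.update l t (Sum.inr x)) a t then (1 : ℝ) else 0) = 0 :=
    Finset.sum_eq_zero fun x _ => by simp
  rw [hz, add_zero, add_mul]
  have hsplit : ∀ x : Fin N, (if (Sum.inl x : Fin N ⊕ Fin M × Fin W).isLeft ∧
      Exposed B T δ h (Function.update l t (Sum.inl x)) a t then (1 : ℝ) else 0) ≤
      (m : ℝ) / h + if Hits B T δ h l a t (Sum.inl x) then 1 else 0 := by
    intro x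
    have hmh : 0 ≤ (m : ℝ) / h := by positivity
    by_cases h1 : Hits B T δ h l a t (Sum.inl x)
    · rw [if_pos h1]
      split_ifs <;> linarith
    · rw [if_neg h1, add_zero]
      split_ifs with h2
      · rcases h2.2 with h3 | h3
        · rw [isolatedTrace_update, ← hm] at h3
          rw [le_div_iff₀ hh', one_mul]
          exact_mod_cast h3
        · rw [hits_update] at h3
          simp only [Function.update_self] at h3
          exact absurd h3 h1
      · exact hmh
  refine (Finset.sum_le_sum fun x _ => hsplit x).trans ?_
  rw [Finset.sum_add_distrib, Finset.sum_const, Finset.card_univ, Fintype.card_fin, nsmul_eq_mul,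
    Finset.sum_boole]
  refine add_le_add (le_of_eq (by ring)) ?_
  rw [one_mul, Nat.cast_le]
  refine le_trans ?_ hcard
  rw [← Finset.card_map ⟨Sum.inl, Sum.inl_injective⟩]
  refine Finset.card_le_card fun x hx => ?_
  obtain ⟨b, hb, rfl⟩ := Finset.mem_map.1 hx
  simpa using hb

-- For each unexposed rare label the real transcript is the isolated one, so each of the at most `N`
-- terms equals the same count.
open Classical in
theorem sum_touching_unexposed_le_aux (l : V → Fin N ⊕ Fin M × Fin W) (a : V → Fin N) {t : V}
    (ht : t ∈ T) :
    (∑ y : Fin N ⊕ Fin M × Fin W,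
      if y.isLeft ∧ ¬ Exposed B T δ h (Function.update l t y) a t then
        (QueryTree.touching t (B.trace (starDist T δ (Function.update l t y) a)) : ℝ) else 0) ≤
    (N : ℝ) * QueryTree.touching t (isolatedTrace B T δ h l a t) := by
  rw [Fintype.sum_sum_type]
  have hz : ∑ x : Fin M × Fin W, (if (Sum.inr x : Fin N ⊕ Fin M × Fin W).isLeft ∧
      ¬ Exposed B T δ h (Function.update l t (Sum.inr x)) a t then
        (QueryTree.touching t (B.trace (starDist T δ (Function.update l t (Sum.inr x)) a)) : ℝ)
      else 0) = 0 :=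
    Finset.sum_eq_zero fun x _ => by simp
  rw [hz, add_zero]
  calc _ ≤ ∑ x : Fin N, (QueryTree.touching t (isolatedTrace B T δ h l a t) : ℝ) := by
        refine Finset.sum_le_sum fun x _ => ?_
        split_ifs with h1
        · rw [isolatedTrace_eq_of_not_exposed ht h1.2, isolatedTrace_update]
        · exact Nat.cast_nonneg _
    _ = _ := by simp

variable [Fintype V]

/-- Comparing each labelling with those in which the label of `t` is resampled. -/
theorem sum_le_of_resample (hM : 2 * h ≤ M) (hN : N ≤ M * W) (hpos : 0 < M * W) (a : V → Fin N)
    (X : (V → Fin N ⊕ Fin M × Fin W) → V → ℝ) (C : ℝ) (hC : 0 ≤ C) (Q : ℝ)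
    (hQ : ∀ l : V → Fin N ⊕ Fin M × Fin W, (B.queries (starDist T δ l a) : ℝ) ≤ Q)
    (hX : ∀ l, ∀ t ∈ T, ∑ y, X (Function.update l t y) t ≤
      C * QueryTree.touching t (isolatedTrace B T δ h l a t)) :
    ∑ l, ∑ t ∈ T, X l t ≤
      8 * C * Q / ((N : ℝ) + M * W) * Fintype.card (V → Fin N ⊕ Fin M × Fin W) := by
  set K : ℝ := (N : ℝ) + M * W with hK
  have hKpos : 0 < K := by
    have : (0 : ℝ) < M * W := by exact_mod_cast hpos
    positivity
  have hcardK : (Fintype.card (Fin N ⊕ Fin M × Fin W) : ℝ) = K := by simp [hK]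
  have hstep : ∀ t ∈ T, ∑ l, X l t ≤ 4 * C / K *
      ∑ l : V → Fin N ⊕ Fin M × Fin W,
        (QueryTree.touching t (B.trace (starDist T δ l a)) : ℝ) := by
    intro t ht
    have h1 : K * ∑ l, X l t ≤ 4 * C * ∑ l : V → Fin N ⊕ Fin M × Fin W,
        (QueryTree.touching t (B.trace (starDist T δ l a)) : ℝ) := by
      calc K * ∑ l, X l t = ∑ l, ∑ y, X (Function.update l t y) t := by
            rw [sum_sum_update t fun l => X l t, hcardK]
        _ ≤ ∑ l, C * (QueryTree.touching t (isolatedTrace B T δ h l a t) : ℝ) :=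
            Finset.sum_le_sum fun l _ => hX l t ht
        _ ≤ ∑ l, C * (4 / K * ∑ y,
              (QueryTree.touching t (B.trace (starDist T δ (Function.update l t y) a)) : ℝ)) := by
            refine Finset.sum_le_sum fun l _ => mul_le_mul_of_nonneg_left ?_ hC
            have := touching_isolatedTrace_mul_le B T δ h hM hN l a ht
            rw [div_mul_eq_mul_div, le_div_iff₀ hKpos]
            exact this
        _ = C * (4 / K) * (K * ∑ l : V → Fin N ⊕ Fin M × Fin W,
              (QueryTree.touching t (B.trace (starDist T δ l a)) : ℝ)) := by
            rw [← hcardK, ← sum_sum_update t fun l : V → Fin N ⊕ Fin M × Fin W =>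
              (QueryTree.touching t (B.trace (starDist T δ l a)) : ℝ), hcardK, Finset.mul_sum]
            exact Finset.sum_congr rfl fun l _ => by ring
        _ = _ := by field_simp
    rw [div_mul_eq_mul_div, le_div_iff₀ hKpos, mul_comm]
    exact h1
  rw [Finset.sum_comm]
  calc _ ≤ ∑ t ∈ T, 4 * C / K * ∑ l : V → Fin N ⊕ Fin M × Fin W,
        (QueryTree.touching t (B.trace (starDist T δ l a)) : ℝ) := Finset.sum_le_sum hstep
    _ = 4 * C / K * ∑ l : V → Fin N ⊕ Fin M × Fin W,
        ∑ t ∈ T, (QueryTree.touching t (B.trace (starDist T δ l a)) : ℝ) := by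
        rw [← Finset.mul_sum, Finset.sum_comm]
    _ ≤ 4 * C / K * ∑ l : V → Fin N ⊕ Fin M × Fin W, 2 * Q := by
        refine mul_le_mul_of_nonneg_left (Finset.sum_le_sum fun l _ => ?_) (by positivity)
        have h1 := QueryTree.sum_touching_le T (B.trace (starDist T δ l a))
        rw [QueryTree.length_trace] at h1
        have h2 : (∑ t ∈ T, (QueryTree.touching t (B.trace (starDist T δ l a)) : ℝ)) ≤
            2 * (B.queries (starDist T δ l a) : ℝ) := by exact_mod_cast h1
        linarith [hQ l]
    _ = _ := by
        rw [Finset.sum_const, Finset.card_univ, nsmul_eq_mul]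
        ring

open Classical in
/-- The average number of exposed terminals with a rare label. -/
theorem sum_card_exposed_le (hh : 0 < h) (hM : 2 * h ≤ M) (hN : N ≤ M * W) (hpos : 0 < M * W)
    (a : V → Fin N) (Q : ℝ)
    (hQ : ∀ l : V → Fin N ⊕ Fin M × Fin W, (B.queries (starDist T δ l a) : ℝ) ≤ Q) :
    ∑ l : V → Fin N ⊕ Fin M × Fin W,
      ((T.filter fun t => (l t).isLeft ∧ Exposed B T δ h l a t).card : ℝ) ≤
      8 * ((N : ℝ) / h + 1) * Q / ((N : ℝ) + M * W) *
        Fintype.card (V → Fin N ⊕ Fin M × Fin W) := by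
  have := sum_le_of_resample B T δ h hM hN hpos a
    (fun l t => if (l t).isLeft ∧ Exposed B T δ h l a t then (1 : ℝ) else 0) ((N : ℝ) / h + 1)
    (by positivity) Q hQ fun l t _ => by
      simpa using sum_exposed_le_aux B T δ h hh l a t
  simpa [Finset.sum_boole] using this

open Classical in
/-- The average number of queries at unexposed terminals with a rare label. -/
theorem sum_touching_unexposed_le (hM : 2 * h ≤ M) (hN : N ≤ M * W) (hpos : 0 < M * W)
    (a : V → Fin N) (Q : ℝ)
    (hQ : ∀ l : V → Fin N ⊕ Fin M × Fin W, (B.queries (starDist T δ l a) : ℝ) ≤ Q) :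
    ∑ l : V → Fin N ⊕ Fin M × Fin W, ∑ t ∈ T,
      (if (l t).isLeft ∧ ¬ Exposed B T δ h l a t then
        (QueryTree.touching t (B.trace (starDist T δ l a)) : ℝ) else 0) ≤
      8 * N * Q / ((N : ℝ) + M * W) * Fintype.card (V → Fin N ⊕ Fin M × Fin W) :=
  sum_le_of_resample B T δ h hM hN hpos a _ N (Nat.cast_nonneg _) Q hQ fun l t ht => by
    simpa using sum_touching_unexposed_le_aux B T δ h l a ht

end Labels

/-! ### Costs of the star and the group family. -/

section Families

variable {V : Type} [Fintype V] [DecidableEq V] {N M W G Z : ℕ}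

/-- A Steiner point with data `x` is close to a whole group of rare classes if `x.2 = 0`, and to the
terminals of just one rare class otherwise. -/
def groupAdj (g : Fin N → Fin G) (x : Fin N × Fin Z) (y : Fin N ⊕ Fin M) : Prop :=
  ∃ b, y = Sum.inl b ∧ if (x.2 : ℕ) = 0 then (g b : ℕ) = x.1 else b = x.1

/-- The metric in which some Steiner points are close to a whole group of rare classes. -/
noncomputable def groupDist (T : Finset V) (δ : ℝ) (l : V → Fin N ⊕ Fin M × Fin W)
    (g : Fin N → Fin G) (f : V → Fin N × Fin Z) : V → V → ℝ :=
  labelDist T δ (fun u => labelClass (l u)) fun s y => groupAdj g (f s) y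

open Classical in
/-- The rare classes that occur among the terminals. -/
noncomputable def hitClasses (T : Finset V) (l : V → Fin N ⊕ Fin M × Fin W) : Finset (Fin N) :=
  Finset.univ.filter fun b => ∃ t ∈ T, l t = Sum.inl b

open Classical in
/-- The rare classes whose group has no Steiner point close to it. -/
noncomputable def uncovered (T : Finset V) (g : Fin N → Fin G) (f : V → Fin N × Fin Z) :
    Finset (Fin N) :=
  Finset.univ.filter fun b => ∀ s ∈ Tᶜ, ¬ (((f s).2 : ℕ) = 0 ∧ (g b : ℕ) = (f s).1)

omit [Fintype V] [DecidableEq V] in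
theorem labelClass_eq_inl {x : Fin N ⊕ Fin M × Fin W} {b : Fin N} :
    labelClass x = Sum.inl b ↔ x = Sum.inl b := by
  cases x <;> simp [labelClass]

theorem le_steinerCost_star [Nonempty V] (T : Finset V) (δ : ℝ) (hδ : 0 < δ) (hδ1 : δ ≤ 1)
    (l : V → Fin N ⊕ Fin M × Fin W) (a : V → Fin N) :
    2 * (((hitClasses T l).card : ℝ) - 1) ≤
      steinerCost (labelMetric T δ hδ hδ1 (fun u => labelClass (l u))
        fun s x => x = Sum.inl (a s)) T := by
  classical
  refine le_trans ?_ (le_steinerCost _ T (vertexClass T l a) 2 zero_le_two fun u v huv =>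
    (starDist_eq_two T δ l a huv).ge)
  have h1 : (hitClasses T l).card ≤ (T.image (vertexClass T l a)).card := by
    rw [← Finset.card_map ⟨Sum.inl, Sum.inl_injective⟩]
    refine Finset.card_le_card fun x hx => ?_
    obtain ⟨b, hb, rfl⟩ := Finset.mem_map.1 hx
    obtain ⟨t, ht, htb⟩ := (Finset.mem_filter.1 hb).2
    exact Finset.mem_image.2 ⟨t, ht, by simp [vertexClass, ht, htb, labelClass]⟩
  have h2 : ((hitClasses T l).card : ℝ) ≤ (T.image (vertexClass T l a)).card := by exact_mod_cast h1
  linarith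

/-- The tree is rooted at a Steiner point: group centres join the root, one representative of each
class joins its centre, and the other terminals join their representative at distance `δ`.
Representatives of frequent or uncovered classes join the root directly, at cost at most 2. -/
theorem steinerCost_group_le (T : Finset V) (hS : Tᶜ.Nonempty) (δ : ℝ) (hδ : 0 < δ) (hδ1 : δ ≤ 1)
    (l : V → Fin N ⊕ Fin M × Fin W) (g : Fin N → Fin G) (f : V → Fin N × Fin Z) :
    steinerCost (labelMetric T δ hδ hδ1 (fun u => labelClass (l u))
        fun s y => groupAdj g (f s) y) T ≤
      (hitClasses T l).card + (uncovered T g f).card + 2 * M + 2 * G + δ * T.card := by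
  classical
  set m := labelMetric T δ hδ hδ1 (fun u => labelClass (l u)) fun s y => groupAdj g (f s) y with hm
  have hd : m.dist = labelDist T δ (fun u => labelClass (l u)) fun s y => groupAdj g (f s) y := rfl
  obtain ⟨r, hr⟩ := hS
  have hrT : r ∉ T := Finset.mem_compl.1 hr
  let c : V → Fin N ⊕ Fin M := fun u => labelClass (l u)
  -- A group without a centre falls back to the root `r`. This is harmless, because its classes are
  -- uncovered and use `r` anyway.
  let ctr : Fin G → V := fun j =>
    if h : ∃ s, s ∉ T ∧ ((f s).2 : ℕ) = 0 ∧ (j : ℕ) = (f s).1 then h.choose else r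
  have hctrT : ∀ j, ctr j ∉ T := by
    intro j
    simp only [ctr]
    split_ifs with h
    · exact h.choose_spec.1
    · exact hrT
  let rep : Fin N ⊕ Fin M → V := fun x => if h : ∃ t, t ∈ T ∧ c t = x then h.choose else r
  have hrep : ∀ t ∈ T, rep (c t) ∈ T ∧ c (rep (c t)) = c t := by
    intro t ht
    have h : ∃ t', t' ∈ T ∧ c t' = c t := ⟨t, ht, rfl⟩
    simp only [rep, dif_pos h]
    exact h.choose_spec
  let up : Fin N ⊕ Fin M → V := fun x => Sum.elim
    (fun b => if b ∈ uncovered T g f then r else ctr (g b)) (fun _ => r) x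
  have hupT : ∀ x, up x ∉ T := by
    rintro (b | b)
    · simp only [up, Sum.elim_inl]
      split_ifs
      · exact hrT
      · exact hctrT _
    · exact hrT
  let C : Finset V := Finset.univ.image ctr
  let parent : V → V := fun v => if v ∈ T then if v = rep (c v) then up (c v) else rep (c v) else r
  let rank : V → ℕ := fun v =>
    if v = r then 0 else if v ∈ T then if v = rep (c v) then 2 else 3 else 1
  have hupW : ∀ x, up x ∈ insert r (T ∪ C) := by
    rintro (b | b)
    · simp only [up, Sum.elim_inl]
      split_ifs
      · exact Finset.mem_insert_self _ _
      · exact Finset.mem_insert_of_mem (Finset.mem_union_right _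
          (Finset.mem_image_of_mem _ (Finset.mem_univ _)))
    · exact Finset.mem_insert_self _ _
  have hmain := steinerCost_le_sum_parent m T (insert r (T ∪ C)) r (Finset.mem_insert_self _ _)
    (Finset.subset_union_left.trans (Finset.subset_insert _ _)) parent rank
    (by
      intro v _ _
      simp only [parent]
      split_ifs with h1 h2
      · exact hupW _
      · exact Finset.mem_insert_of_mem (Finset.mem_union_left _ (hrep v h1).1)
      · exact Finset.mem_insert_self _ _)
    (by
      intro v _ hvr
      have hne : ∀ t ∈ T, t ≠ r := fun t ht h => hrT (h ▸ ht)
      simp only [parent, rank]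
      by_cases h1 : v ∈ T
      · by_cases h2 : v = rep (c v)
        · rw [if_pos h1, if_pos h2, if_neg hvr, if_pos h1, if_pos h2, if_neg (hupT _)]
          split_ifs <;> norm_num
        · have h3 := hrep v h1
          rw [if_pos h1, if_neg h2, if_neg hvr, if_pos h1, if_neg h2, if_neg (hne _ h3.1),
            if_pos h3.1, if_pos (by rw [h3.2])]
          norm_num
      · rw [if_neg h1, if_pos rfl, if_neg hvr, if_neg h1]
        norm_num)
  refine hmain.trans ?_
  let wt : Fin N ⊕ Fin M → ℝ := Sum.elim (fun b => 1 + if b ∈ uncovered T g f then 1 else 0) fun _ => 2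
  have hwt : ∀ x, 0 ≤ wt x := by
    rintro (b | b)
    · simp only [wt, Sum.elim_inl]
      split_ifs <;> norm_num
    · simp [wt]
  have hle2 : ∀ u v, m.dist u v ≤ 2 := by
    intro u v
    rw [hd]
    unfold labelDist
    split_ifs <;> linarith
  have hT : ∀ v ∈ T, m.dist v (parent v) ≤ δ + if v = rep (c v) then wt (c v) else 0 := by
    intro v hv
    by_cases h2 : v = rep (c v)
    · rw [if_pos h2]
      have : m.dist v (parent v) ≤ wt (c v) := by
        rcases hx : c v with b | b
        · simp only [wt, Sum.elim_inl]
          by_cases hb : b ∈ uncovered T g f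
          · rw [if_pos hb]
            exact (hle2 _ _).trans (by norm_num)
          · rw [if_neg hb, add_zero]
            have hpar : parent v = ctr (g b) := by
              simp only [parent]
              rw [if_pos hv, if_pos h2, hx]
              simp [up, hb]
            have hex : ∃ s, s ∉ T ∧ ((f s).2 : ℕ) = 0 ∧ ((g b : Fin G) : ℕ) = (f s).1 := by
              simp only [uncovered, Finset.mem_filter, Finset.mem_univ, true_and, not_forall,
                not_not, Finset.mem_compl] at hb
              obtain ⟨s, hs, h⟩ := hb
              exact ⟨s, hs, h⟩
            have hspec := hex.choose_spec
            have hctr : ctr (g b) = hex.choose := by simp only [ctr, dif_pos hex]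
            rw [← hctr] at hspec
            have hadj : groupAdj (M := M) g (f (ctr (g b))) (labelClass (l v)) :=
              ⟨b, hx, by rw [if_pos hspec.2.1]; exact hspec.2.2⟩
            have hne : v ≠ ctr (g b) := fun h => hctrT (g b) (h ▸ hv)
            rw [hpar, hd]
            simp [labelDist, hne, hv, hctrT, hadj]
        · exact (hle2 _ _).trans (by simp [wt])
      linarith
    · rw [if_neg h2, add_zero]
      have h3 := hrep v hv
      have hpar : parent v = rep (c v) := by simp only [parent]; rw [if_pos hv, if_neg h2]
      have h4 : labelClass (l v) = labelClass (l (rep (c v))) := h3.2.symm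
      rw [hpar, hd]
      unfold labelDist
      rw [if_neg h2, if_pos hv, if_pos h3.1, if_pos h4]
  have hsub : (insert r (T ∪ C)).erase r ⊆ T ∪ C := Finset.erase_insert_subset _ _
  have hnn : ∀ v, 0 ≤ m.dist v (parent v) := fun v => dist_nonneg
  have hreps : ∑ v ∈ T, (if v = rep (c v) then wt (c v) else 0) ≤
      (hitClasses T l).card + (uncovered T g f).card + 2 * M := by
    rw [← Finset.sum_filter]
    have hinj : Set.InjOn c (T.filter fun v => v = rep (c v) : Finset V) := by
      intro u hu v hv huv
      have hu := (Finset.mem_filter.1 (Finset.mem_coe.1 hu)).2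
      have hv := (Finset.mem_filter.1 (Finset.mem_coe.1 hv)).2
      rw [hu, hv, huv]
    rw [← Finset.sum_image (f := wt) hinj]
    let I : Finset (Fin N ⊕ Fin M) := (hitClasses T l).disjSum Finset.univ
    have hI : (T.filter fun v => v = rep (c v)).image c ⊆ I := by
      intro x hx
      obtain ⟨t, ht, rfl⟩ := Finset.mem_image.1 hx
      have ht := (Finset.mem_filter.1 ht).1
      rcases hx : c t with b | b
      · simp only [I, Finset.inl_mem_disjSum, hitClasses, Finset.mem_filter, Finset.mem_univ,
          true_and]
        exact ⟨t, ht, labelClass_eq_inl.1 hx⟩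
      · simp [I]
    refine (Finset.sum_le_sum_of_subset_of_nonneg hI fun x _ _ => hwt x).trans ?_
    rw [Finset.sum_disjSum]
    simp only [wt, Sum.elim_inl, Sum.elim_inr, Finset.sum_add_distrib, Finset.sum_const,
      nsmul_eq_mul, mul_one, Finset.card_univ, Fintype.card_fin, Finset.sum_boole]
    have : ((hitClasses T l).filter fun b => b ∈ uncovered T g f).card ≤ (uncovered T g f).card :=
      Finset.card_le_card fun b hb => (Finset.mem_filter.1 hb).2
    have : (((hitClasses T l).filter fun b => b ∈ uncovered T g f).card : ℝ) ≤
      (uncovered T g f).card := by exact_mod_cast this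
    linarith
  have hC : (C.card : ℝ) ≤ G := by
    have : C.card ≤ G := Finset.card_image_le.trans (by simp)
    exact_mod_cast this
  calc _ ≤ ∑ v ∈ T ∪ C, m.dist v (parent v) :=
        Finset.sum_le_sum_of_subset_of_nonneg hsub fun v _ _ => hnn v
    _ ≤ ∑ v ∈ T, m.dist v (parent v) + ∑ v ∈ C, m.dist v (parent v) := by
        rw [← Finset.sum_union_inter]
        exact le_add_of_nonneg_right (Finset.sum_nonneg fun v _ => hnn v)
    _ ≤ ∑ v ∈ T, (δ + if v = rep (c v) then wt (c v) else 0) + ∑ v ∈ C, (2 : ℝ) :=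
        add_le_add (Finset.sum_le_sum hT) (Finset.sum_le_sum fun v _ => hle2 _ _)
    _ ≤ _ := by
        rw [Finset.sum_add_distrib, Finset.sum_const, Finset.sum_const, nsmul_eq_mul, nsmul_eq_mul]
        linarith

end Families

/-! ### Likelihood loss at a single Steiner point. -/

section Likelihood

open Classical in
/-- The answers about the rare classes in `R` that point to the class `a` are almost as likely for a
Steiner point that may be close to a whole group. -/
theorem card_consistent_le {N G Z : ℕ} (hG : G ≤ N) (hZ : 0 < Z) (g : Fin N → Fin G)
    (R : Finset (Fin N)) (a : Fin N) :
    (1 - (if a ∈ R ∧ ∃ b ∈ R, b ≠ a ∧ g b = g a then 1 / (Z : ℝ) else 0)) *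
      ((Finset.univ.filter fun x : Fin N × Fin Z => ∀ b ∈ R, x.1 = b ↔ a = b).card : ℝ) ≤
    ((Finset.univ.filter fun x : Fin N × Fin Z => ∀ b ∈ R,
      (if (x.2 : ℕ) = 0 then (g b : ℕ) = x.1 else b = x.1) ↔ a = b).card : ℝ) := by
  have hZ' : (0 : ℝ) < Z := by exact_mod_cast hZ
  let z0 : Fin Z := ⟨0, hZ⟩
  have hz0 : ∀ z : Fin Z, (z : ℕ) = 0 ↔ z = z0 := fun z => by
    rw [Fin.ext_iff]
  let ι : Fin G → Fin N := Fin.castLE hG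
  set S := Finset.univ.filter fun x : Fin N × Fin Z => ∀ b ∈ R,
      (if (x.2 : ℕ) = 0 then (g b : ℕ) = x.1 else b = x.1) ↔ a = b with hS
  -- Data with nonzero second entry behave identically in both families. Only the slice at `z0`,
  -- where the first entry is read as a group number, has to be compensated.
  by_cases haR : a ∈ R
  · have hL : (Finset.univ.filter fun x : Fin N × Fin Z => ∀ b ∈ R, x.1 = b ↔ a = b) ⊆
        {a} ×ˢ Finset.univ := by
      intro x hx
      have := (Finset.mem_filter.1 hx).2 a haR
      exact Finset.mem_product.2 ⟨Finset.mem_singleton.2 (this.2 rfl), Finset.mem_univ _⟩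
    have hLc := Finset.card_le_card hL
    rw [Finset.card_product, Finset.card_singleton, one_mul, Finset.card_univ,
      Fintype.card_fin] at hLc
    have hLc' : ((Finset.univ.filter fun x : Fin N × Fin Z =>
      ∀ b ∈ R, x.1 = b ↔ a = b).card : ℝ) ≤ Z := by exact_mod_cast hLc
    have hmem : ∀ z : Fin Z, z ≠ z0 → (a, z) ∈ S := by
      intro z hz
      rw [hS, Finset.mem_filter]
      refine ⟨Finset.mem_univ _, fun b _ => ?_⟩
      rw [if_neg (by rw [hz0]; exact hz)]
      exact eq_comm
    by_cases hbad : ∃ b ∈ R, b ≠ a ∧ g b = g a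
    · rw [if_pos ⟨haR, hbad⟩]
      have h1 : ({a} : Finset (Fin N)) ×ˢ (Finset.univ.erase z0) ⊆ S := by
        rintro ⟨x, z⟩ hx
        simp only [Finset.mem_product, Finset.mem_singleton, Finset.mem_erase, Finset.mem_univ,
          and_true] at hx
        rw [hx.1]
        exact hmem z hx.2
      have h2 := Finset.card_le_card h1
      rw [Finset.card_product, Finset.card_singleton, one_mul,
        Finset.card_erase_of_mem (Finset.mem_univ _), Finset.card_univ, Fintype.card_fin] at h2
      have h3 : (Z : ℝ) - 1 ≤ S.card := by
        have : Z ≤ S.card + 1 := by omega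
        have : (Z : ℝ) ≤ S.card + 1 := by exact_mod_cast this
        linarith
      have h4 : 0 ≤ 1 - 1 / (Z : ℝ) := by
        rw [sub_nonneg, div_le_one hZ']
        exact_mod_cast hZ
      calc _ ≤ (1 - 1 / (Z : ℝ)) * Z := mul_le_mul_of_nonneg_left hLc' h4
        _ = Z - 1 := by field_simp
        _ ≤ _ := h3
    · rw [if_neg fun h => hbad h.2, sub_zero, one_mul]
      refine hLc'.trans ?_
      rw [Nat.cast_le]
      calc Z = (Finset.univ : Finset (Fin Z)).card := by simp
        _ ≤ S.card := by
          -- The lost datum `(a, z0)` is replaced by the centre of the group of `a`. It gives the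
          -- same answers because no other class of `R` lies in that group.
          refine Finset.card_le_card_of_injOn
            (fun z => if z = z0 then (ι (g a), z0) else (a, z)) ?_ ?_
          · intro z _
            by_cases hz : z = z0
            · simp only [hz, if_true]
              rw [Finset.mem_coe, hS, Finset.mem_filter]
              refine ⟨Finset.mem_univ _, fun b hb => ?_⟩
              rw [if_pos rfl]
              constructor
              · intro h
                by_contra hne
                exact hbad ⟨b, hb, fun h => hne h.symm, Fin.ext h⟩
              · rintro rfl
                rfl
            · simp only [hz, if_false]
              exact hmem z hz
          · intro z _ z' _ h
            by_cases h1 : z = z0 <;> by_cases h2 : z' = z0 <;> simp_all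
  · rw [if_neg fun h => haR h.1, sub_zero, one_mul]
    have hL : (Finset.univ.filter fun x : Fin N × Fin Z => ∀ b ∈ R, x.1 = b ↔ a = b) ⊆
        Rᶜ ×ˢ Finset.univ := by
      intro x hx
      rw [Finset.mem_product]
      refine ⟨?_, Finset.mem_univ _⟩
      rw [Finset.mem_compl]
      intro hxR
      exact haR (((Finset.mem_filter.1 hx).2 x.1 hxR).1 rfl ▸ hxR)
    -- When all answers are negative, the slice at `z0` must avoid the groups of `R`. There are at
    -- most `R.card` of these, so it keeps at least as many values as it had.
    let I : Finset (Fin N) := R.image fun b => ι (g b)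
    have hI : Rᶜ.card ≤ Iᶜ.card := by
      rw [Finset.card_compl, Finset.card_compl]
      exact Nat.sub_le_sub_left Finset.card_image_le _
    have hR : Rᶜ ×ˢ (Finset.univ.erase z0) ∪ Iᶜ ×ˢ {z0} ⊆ S := by
      rintro ⟨x, z⟩ hx
      have hne : ∀ b ∈ R, a ≠ b := fun b hb h => haR (h ▸ hb)
      rw [hS, Finset.mem_filter]
      refine ⟨Finset.mem_univ _, fun b hb => ?_⟩
      rw [iff_false_right (hne b hb)]
      rw [Finset.mem_union] at hx
      rcases hx with hx | hx
      · simp only [Finset.mem_product, Finset.mem_compl, Finset.mem_erase, Finset.mem_univ,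
          and_true] at hx
        rw [if_neg (by rw [hz0]; exact hx.2)]
        rintro rfl
        exact hx.1 hb
      · simp only [Finset.mem_product, Finset.mem_compl, Finset.mem_singleton] at hx
        rw [if_pos (by rw [hz0]; exact hx.2)]
        intro h
        exact hx.1 (Finset.mem_image.2 ⟨b, hb, Fin.ext h⟩)
    have hdisj : Disjoint (Rᶜ ×ˢ (Finset.univ.erase z0)) (Iᶜ ×ˢ ({z0} : Finset (Fin Z))) := by
      rw [Finset.disjoint_left]
      rintro ⟨x, z⟩ h1 h2
      simp only [Finset.mem_product, Finset.mem_erase, Finset.mem_singleton] at h1 h2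
      exact h1.2.1 h2.2
    have h1 := Finset.card_le_card hL
    have h2 := Finset.card_le_card hR
    rw [Finset.card_union_of_disjoint hdisj, Finset.card_product, Finset.card_product,
      Finset.card_singleton, Finset.card_erase_of_mem (Finset.mem_univ _), Finset.card_univ,
      Fintype.card_fin, mul_one] at h2
    rw [Finset.card_product, Finset.card_univ, Fintype.card_fin] at h1
    rw [Nat.cast_le]
    refine h1.trans (le_trans ?_ h2)
    obtain ⟨Z, rfl⟩ : ∃ Z', Z = Z' + 1 := ⟨Z - 1, by omega⟩
    rw [Nat.add_sub_cancel, mul_add, mul_one]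
    omega

end Likelihood

/-! ### Steiner points as independent coordinates. -/

section Owner

variable {V : Type} [Fintype V] [DecidableEq V] {N M W G Z : ℕ}

/-- The Steiner point of a pair of a terminal and a Steiner point. -/
def owner (T : Finset V) (u v : V) : V := if u ∈ T then v else u

/-- The distance of a pair as a function of the data of its owner. -/
noncomputable def ownedDist {Λ : Type} (T : Finset V) (δ : ℝ) (l : V → Fin N ⊕ Fin M × Fin W)
    (P : Λ → Fin N ⊕ Fin M → Prop) (u v : V) (x : Λ) : ℝ :=
  labelDist T δ (fun u => labelClass (l u)) (fun _ y => P x y) u v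

omit [Fintype V] in
theorem ownedDist_owner {Λ : Type} (T : Finset V) (δ : ℝ) (l : V → Fin N ⊕ Fin M × Fin W)
    (P : Λ → Fin N ⊕ Fin M → Prop) (f : V → Λ) (u v : V) :
    ownedDist T δ l P u v (f (owner T u v)) =
      labelDist T δ (fun u => labelClass (l u)) (fun s y => P (f s) y) u v := by
  by_cases hu : u ∈ T
  · rw [show owner T u v = v from if_pos hu]
    unfold ownedDist labelDist
    simp only [hu, if_true]
  · rw [show owner T u v = u from if_neg hu]
    unfold ownedDist labelDist
    simp only [hu, if_false]

omit [Fintype V] in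
/-- The answer is the same for two values of the data of the owner if they agree about the class of
the terminal. -/
theorem ownedDist_congr {Λ Λ' : Type} (T : Finset V) (δ : ℝ) (l : V → Fin N ⊕ Fin M × Fin W)
    (P : Λ → Fin N ⊕ Fin M → Prop) (P' : Λ' → Fin N ⊕ Fin M → Prop) (u v : V) (x : Λ) (x' : Λ')
    (h : ∀ t ∈ T, (u = t ∧ v = owner T u v ∨ v = t ∧ u = owner T u v) → owner T u v ∉ T →
      (P x (labelClass (l t)) ↔ P' x' (labelClass (l t)))) :
    ownedDist T δ l P u v x = ownedDist T δ l P' u v x' := by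
  unfold ownedDist labelDist
  by_cases hu : u ∈ T <;> by_cases hv : v ∈ T <;> simp only [hu, hv, if_true, if_false]
  · have := h u hu (Or.inl ⟨rfl, by simp [owner, hu]⟩) (by simpa [owner, hu] using hv)
    split_ifs <;> first | rfl | (exfalso; tauto)
  · have := h v hv (Or.inr ⟨rfl, by simp [owner, hu]⟩) (by simp [owner, hu])
    split_ifs <;> first | rfl | (exfalso; tauto)

/-- `u` and `v` are compared by a query of the list. -/
def Asked (tr : List (V × V)) (u v : V) : Prop := (u, v) ∈ tr ∨ (v, u) ∈ tr

/-- The queries have revealed a terminal close to the Steiner point `s`, and compared `s` with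
another rare class of the same group. -/
def Suspicious (T : Finset V) (tr : List (V × V)) (l : V → Fin N ⊕ Fin M × Fin W)
    (g : Fin N → Fin G) (a : V → Fin N) (s : V) : Prop :=
  s ∉ T ∧ (∃ t ∈ T, Asked tr t s ∧ l t = Sum.inl (a s)) ∧
    ∃ t ∈ T, Asked tr t s ∧ ∃ b, l t = Sum.inl b ∧ b ≠ a s ∧ g b = g (a s)

open Classical in
/-- For fixed labels and groups, the two families of metrics are hard to distinguish. -/
theorem card_accept_star_sub_group_le (B : QueryTree V) (T : Finset V) (δ : ℝ) (hG : G ≤ N)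
    (hZ : 0 < Z) (l : V → Fin N ⊕ Fin M × Fin W) (g : Fin N → Fin G) (acc : ℝ → Prop) :
    ((Finset.univ.filter fun f : V → Fin N × Fin Z =>
        acc (B.output (starDist T δ l fun s => (f s).1))).card : ℝ) -
      (Finset.univ.filter fun f : V → Fin N × Fin Z =>
        acc (B.output (groupDist T δ l g f))).card ≤
      ∑ f : V → Fin N × Fin Z, min 1 (∑ s, if Suspicious T
        (B.trace (starDist T δ l fun s => (f s).1)) l g (fun s => (f s).1) s
        then 1 / (Z : ℝ) else 0) := by
  let P : Fin N × Fin Z → Fin N ⊕ Fin M → Prop := fun x y => y = Sum.inl x.1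
  let P' : Fin N × Fin Z → Fin N ⊕ Fin M → Prop := fun x y => groupAdj g x y
  have hφ : ∀ f : V → Fin N × Fin Z, (fun u v => ownedDist T δ l P u v (f (owner T u v))) =
      starDist T δ l fun s => (f s).1 := fun f => by
    funext u v
    exact ownedDist_owner T δ l P f u v
  have hψ : ∀ f : V → Fin N × Fin Z, (fun u v => ownedDist T δ l P' u v (f (owner T u v))) =
      groupDist T δ l g f := fun f => by
    funext u v
    exact ownedDist_owner T δ l P' f u v
  have hZ1 : 1 / (Z : ℝ) ≤ 1 := by
    rw [div_le_one (by exact_mod_cast hZ)]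
    exact_mod_cast hZ
  have key := card_accept_sub_le B (owner T) (ownedDist T δ l P) (ownedDist T δ l P') acc
    (fun f s => if Suspicious T (B.trace (starDist T δ l fun s => (f s).1)) l g
      (fun s => (f s).1) s then 1 / (Z : ℝ) else 0)
    (fun f s => by positivity) (fun f s => by split_ifs; exacts [hZ1, zero_le_one]) ?_
  · simpa only [hφ, hψ] using key
  intro f s
  simp only [hφ]
  set tr := B.trace (starDist T δ l fun s => (f s).1) with htr
  -- A terminal owns only pairs of terminals, whose distance does not depend on the data.
  by_cases hs : s ∈ T
  · have hfull : (Finset.univ.filter fun x : Fin N × Fin Z => ∀ e ∈ tr, owner T e.1 e.2 = s →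
        ownedDist T δ l P' e.1 e.2 x = ownedDist T δ l P e.1 e.2 (f s)) = Finset.univ := by
      rw [Finset.filter_true_of_mem]
      intro x _ e _ he
      exact ownedDist_congr T δ l P' P e.1 e.2 x (f s) fun t _ _ h => absurd (he ▸ hs) h
    rw [hfull, if_neg fun h => h.1 hs, sub_zero, one_mul, Nat.cast_le]
    exact Finset.card_le_card (Finset.subset_univ _)
  let R : Finset (Fin N) := Finset.univ.filter fun b => ∃ t ∈ T, Asked tr t s ∧ l t = Sum.inl b
  have hsusp : Suspicious T tr l g (fun s => (f s).1) s ↔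
      (f s).1 ∈ R ∧ ∃ b ∈ R, b ≠ (f s).1 ∧ g b = g (f s).1 := by
    simp only [Suspicious, R, Finset.mem_filter, Finset.mem_univ, true_and]
    constructor
    · rintro ⟨-, h1, t, ht, ha, b, hb, h2⟩
      exact ⟨h1, b, ⟨t, ht, ha, hb⟩, h2⟩
    · rintro ⟨h1, b, ⟨t, ht, ha, hb⟩, h2⟩
      exact ⟨hs, h1, t, ht, ha, b, hb, h2⟩
  have hown : ∀ t ∈ T, owner T t s = s ∧ owner T s t = s := fun t ht => by simp [owner, ht, hs]
  have hleft : (Finset.univ.filter fun x : Fin N × Fin Z => ∀ e ∈ tr, owner T e.1 e.2 = s →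
      ownedDist T δ l P e.1 e.2 x = ownedDist T δ l P e.1 e.2 (f s)) ⊆
      Finset.univ.filter fun x : Fin N × Fin Z => ∀ b ∈ R, x.1 = b ↔ (f s).1 = b := by
    intro x hx
    rw [Finset.mem_filter] at hx ⊢
    refine ⟨Finset.mem_univ _, fun b hb => ?_⟩
    obtain ⟨t, ht, hts, hlt⟩ := (Finset.mem_filter.1 hb).2
    have hne : t ≠ s := fun h => hs (h ▸ ht)
    have hc : labelClass (l t) = Sum.inl b := labelClass_eq_inl.2 hlt
    rcases hts with h | h
    · have := hx.2 _ h (hown t ht).1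
      simp only [ownedDist, labelDist, hne, ht, hs, if_true, if_false, hc, P, Sum.inl.injEq] at this
      by_cases h1 : b = x.1 <;> by_cases h2 : b = (f s).1 <;> simp_all [eq_comm]
    · have := hx.2 _ h (hown t ht).2
      simp only [ownedDist, labelDist, hne.symm, ht, hs, if_true, if_false, hc, P,
        Sum.inl.injEq] at this
      by_cases h1 : b = x.1 <;> by_cases h2 : b = (f s).1 <;> simp_all [eq_comm]
  have hright : (Finset.univ.filter fun x : Fin N × Fin Z => ∀ b ∈ R,
      (if (x.2 : ℕ) = 0 then (g b : ℕ) = x.1 else b = x.1) ↔ (f s).1 = b) ⊆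
      Finset.univ.filter fun x : Fin N × Fin Z => ∀ e ∈ tr, owner T e.1 e.2 = s →
      ownedDist T δ l P' e.1 e.2 x = ownedDist T δ l P e.1 e.2 (f s) := by
    intro x hx
    rw [Finset.mem_filter] at hx ⊢
    refine ⟨Finset.mem_univ _, fun e he hes => ?_⟩
    refine ownedDist_congr T δ l P' P e.1 e.2 x (f s) fun t ht htn _ => ?_
    rw [hes] at htn
    rcases hlt : l t with b | b
    · have hb : b ∈ R := by
        simp only [R, Finset.mem_filter, Finset.mem_univ, true_and]
        refine ⟨t, ht, ?_, hlt⟩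
        rcases htn with ⟨h1, h2⟩ | ⟨h1, h2⟩
        · exact Or.inl (by rw [← h1, ← h2]; exact he)
        · exact Or.inr (by rw [← h1, ← h2]; exact he)
      have := hx.2 b hb
      simp only [P', P, groupAdj, labelClass, Sum.map_inl, id, Sum.inl.injEq]
      rw [eq_comm (a := b) (b := (f s).1), ← this]
      constructor
      · rintro ⟨b', rfl, h⟩
        exact h
      · intro h
        exact ⟨b, rfl, h⟩
    · simp [P', P, groupAdj, labelClass]
  have hcount := card_consistent_le hG hZ g R (f s).1
  have hnn : 0 ≤ 1 - (if Suspicious T tr l g (fun s => (f s).1) s then 1 / (Z : ℝ) else 0) := by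
    split_ifs <;> linarith
  refine (mul_le_mul_of_nonneg_left (Nat.cast_le.2 (Finset.card_le_card hleft)) hnn).trans ?_
  refine le_trans ?_ (Nat.cast_le.2 (Finset.card_le_card hright))
  simpa only [hsusp] using hcount

end Owner

/-! ### Counting suspicious Steiner points. -/

section Collisions

variable {V : Type} [Fintype V] [DecidableEq V] {N M W G Z : ℕ}

/-- Resampling the group of `b` alone makes it agree with that of `a` for exactly one of the `G`
values. -/
theorem card_collision {a b : Fin N} (hab : b ≠ a) :
    (G : ℝ) * ((Finset.univ.filter fun g : Fin N → Fin G => g b = g a).card : ℝ) =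
      Fintype.card (Fin N → Fin G) := by
  have h := sum_sum_update b fun g : Fin N → Fin G => if g b = g a then (1 : ℝ) else 0
  simp only [Function.update_self, Function.update_of_ne hab.symm, Finset.sum_ite_eq',
    Finset.mem_univ, if_true, Finset.sum_const, nsmul_eq_mul, mul_one, Finset.card_univ,
    Fintype.card_fin, Finset.sum_boole] at h
  exact h.symm

omit [Fintype V] in
open Classical in
theorem card_asked_le (tr : List (V × V)) (t : V) (S : Finset V) :
    (S.filter fun s => Asked tr t s).card ≤ QueryTree.touching t tr := by
  have hsub : (S.filter fun s => Asked tr t s) ⊆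
      ((tr.filter fun e => decide (e.1 = t ∨ e.2 = t)).map
        fun e => if e.1 = t then e.2 else e.1).toFinset := by
    intro s hs
    simp only [List.mem_toFinset, List.mem_map, List.mem_filter, decide_eq_true_eq]
    rcases (Finset.mem_filter.1 hs).2 with h | h
    · exact ⟨_, ⟨h, Or.inl rfl⟩, by simp⟩
    · refine ⟨_, ⟨h, Or.inr rfl⟩, ?_⟩
      by_cases hst : s = t <;> simp [hst]
  refine (Finset.card_le_card hsub).trans ((List.toFinset_card_le _).trans ?_)
  rw [List.length_map, ← List.countP_eq_length_filter]
  exact le_rfl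

open Classical in
/-- Random groups rarely make a Steiner point suspicious. -/
theorem sum_card_suspicious_le (B : QueryTree V) (T : Finset V) (δ : ℝ) (h : ℕ)
    (l : V → Fin N ⊕ Fin M × Fin W) (a : V → Fin N) (D : ℝ)
    (hD : ∀ b, ((Tᶜ.filter fun s => a s = b).card : ℝ) ≤ D) :
    (G : ℝ) * ∑ g : Fin N → Fin G, ((Finset.univ.filter fun s =>
        Suspicious T (B.trace (starDist T δ l a)) l g a s).card : ℝ) ≤
      Fintype.card (Fin N → Fin G) * ((∑ t ∈ T,
        if (l t).isLeft ∧ ¬ Exposed B T δ h l a t then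
          (QueryTree.touching t (B.trace (starDist T δ l a)) : ℝ) else 0) +
        ((T.filter fun t => (l t).isLeft ∧ Exposed B T δ h l a t).card : ℝ) ^ 2 * D) := by
  set tr := B.trace (starDist T δ l a) with htr
  set X := T.filter fun t => (l t).isLeft ∧ Exposed B T δ h l a t with hX
  -- `Y s t'` is the part of suspicion that does not involve the groups. Given it, a collision costs
  -- a factor `1 / G`, so it remains to count these pairs.
  let Y : V → V → Prop := fun s t' => s ∈ Tᶜ ∧ (∃ t ∈ T, Asked tr t s ∧ l t = Sum.inl (a s)) ∧
    Asked tr t' s ∧ (l t').isLeft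
  let c : V → V → (Fin N → Fin G) → Prop := fun s t' g =>
    Y s t' ∧ ∃ b, l t' = Sum.inl b ∧ b ≠ a s ∧ g b = g (a s)
  have hcount : ∀ s t', (G : ℝ) * ∑ g : Fin N → Fin G, (if c s t' g then (1 : ℝ) else 0) ≤
      Fintype.card (Fin N → Fin G) * if Y s t' then 1 else 0 := by
    intro s t'
    by_cases hY : Y s t'
    · rw [if_pos hY, mul_one]
      by_cases hb : ∃ b, l t' = Sum.inl b ∧ b ≠ a s
      · obtain ⟨b, hlb, hba⟩ := hb
        rw [← card_collision hba, Finset.sum_boole]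
        refine mul_le_mul_of_nonneg_left ?_ (Nat.cast_nonneg _)
        rw [Nat.cast_le]
        refine Finset.card_le_card fun g hg => ?_
        obtain ⟨-, b', hb', -, hg'⟩ := (Finset.mem_filter.1 hg).2
        have : b' = b := Sum.inl_injective (hb'.symm.trans hlb)
        exact Finset.mem_filter.2 ⟨Finset.mem_univ _, this ▸ hg'⟩
      · rw [Finset.sum_eq_zero, mul_zero]
        · exact Nat.cast_nonneg _
        · intro g _
          rw [if_neg]
          rintro ⟨-, b, h1, h2, -⟩
          exact hb ⟨b, h1, h2⟩
    · rw [if_neg hY, mul_zero, Finset.sum_eq_zero, mul_zero]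
      intro g _
      rw [if_neg]
      exact fun hc => hY hc.1
  have hsusp : ∀ g s, (if Suspicious T tr l g a s then (1 : ℝ) else 0) ≤
      ∑ t' ∈ T, if c s t' g then (1 : ℝ) else 0 := by
    intro g s
    split_ifs with hs
    · obtain ⟨hsT, h1, t', ht', hask, b, hb, h2⟩ := hs
      have hc : c s t' g :=
        ⟨⟨Finset.mem_compl.2 hsT, h1, hask, by simp [hb]⟩, b, hb, h2⟩
      refine le_trans ?_ (Finset.single_le_sum
        (f := fun t' => if c s t' g then (1 : ℝ) else 0) (fun t _ => by positivity) ht')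
      simp [hc]
    · exact Finset.sum_nonneg fun t _ => by positivity
  have hYle : ∀ t' ∈ T, (∑ s, if Y s t' then (1 : ℝ) else 0) ≤
      (if (l t').isLeft ∧ ¬ Exposed B T δ h l a t' then (QueryTree.touching t' tr : ℝ) else 0) +
        if (l t').isLeft ∧ Exposed B T δ h l a t' then (X.card : ℝ) * D else 0 := by
    intro t' ht'
    rw [Finset.sum_boole]
    by_cases hl : (l t').isLeft
    -- For unexposed `t'`, the candidates `s` are bounded by the queries at `t'`. For exposed `t'`,
    -- each `s` has a revealed close terminal, itself exposed, and at most `D` Steiner points share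
    -- its class.
    · by_cases he : Exposed B T δ h l a t'
      · simp only [hl, he, not_true, and_false, if_false, true_and, if_true, zero_add]
        have hsub : (Finset.univ.filter fun s => Y s t') ⊆
            X.biUnion fun t => Tᶜ.filter fun s => Sum.inl (a s) = labelClass (l t) := by
          intro s hs
          obtain ⟨hsT, ⟨t, ht, hask, hlt⟩, -⟩ := (Finset.mem_filter.1 hs).2
          have hsT' := Finset.mem_compl.1 hsT
          rw [Finset.mem_biUnion]
          refine ⟨t, ?_, Finset.mem_filter.2 ⟨hsT, by simp [hlt, labelClass]⟩⟩
          rw [hX, Finset.mem_filter]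
          refine ⟨ht, by simp [hlt], exposed_of_mem_trace ht
            (fun hst : s = t => hsT' (by rw [hst]; exact ht)) ?_ hask⟩
          simp [vertexClass, hsT', hlt, labelClass]
        have h1 : (Finset.univ.filter fun s => Y s t').card ≤
            ∑ t ∈ X, (Tᶜ.filter fun s => Sum.inl (a s) = labelClass (l t)).card :=
          (Finset.card_le_card hsub).trans Finset.card_biUnion_le
        calc ((Finset.univ.filter fun s => Y s t').card : ℝ) ≤
            ∑ t ∈ X, ((Tᶜ.filter fun s => Sum.inl (a s) = labelClass (l t)).card : ℝ) := by
              exact_mod_cast h1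
          _ ≤ ∑ t ∈ X, D := by
              refine Finset.sum_le_sum fun t ht => ?_
              have htl := (Finset.mem_filter.1 ht).2.1
              obtain ⟨b, hb⟩ := Sum.isLeft_iff.1 htl
              refine le_trans (le_of_eq ?_) (hD b)
              simp [hb, labelClass]
          _ = _ := by simp
      · simp only [hl, he, not_false_eq_true, and_self, if_true, and_false, if_false, add_zero]
        rw [Nat.cast_le]
        refine le_trans (Finset.card_le_card fun s hs => ?_) (card_asked_le tr t' Finset.univ)
        exact Finset.mem_filter.2 ⟨Finset.mem_univ _, (Finset.mem_filter.1 hs).2.2.2.1⟩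
    · simp [Y, hl]
  calc (G : ℝ) * ∑ g : Fin N → Fin G, ((Finset.univ.filter fun s =>
        Suspicious T tr l g a s).card : ℝ)
      = (G : ℝ) * ∑ g : Fin N → Fin G, ∑ s, if Suspicious T tr l g a s then (1 : ℝ) else 0 := by
        simp only [Finset.sum_boole]
    _ ≤ (G : ℝ) * ∑ g : Fin N → Fin G, ∑ s, ∑ t' ∈ T, if c s t' g then (1 : ℝ) else 0 :=
        mul_le_mul_of_nonneg_left (Finset.sum_le_sum fun g _ => Finset.sum_le_sum fun s _ =>
          hsusp g s) (Nat.cast_nonneg _)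
    _ = ∑ t' ∈ T, ∑ s, (G : ℝ) * ∑ g : Fin N → Fin G, if c s t' g then (1 : ℝ) else 0 := by
        rw [Finset.sum_comm]
        simp only [Finset.mul_sum]
        rw [Finset.sum_congr rfl fun s _ => Finset.sum_comm, Finset.sum_comm]
    _ ≤ ∑ t' ∈ T, ∑ s, (Fintype.card (Fin N → Fin G) : ℝ) * if Y s t' then 1 else 0 :=
        Finset.sum_le_sum fun t' _ => Finset.sum_le_sum fun s _ => hcount s t'
    _ = Fintype.card (Fin N → Fin G) * ∑ t' ∈ T, ∑ s, if Y s t' then (1 : ℝ) else 0 := by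
        simp only [Finset.mul_sum]
    _ ≤ Fintype.card (Fin N → Fin G) * ∑ t' ∈ T,
        ((if (l t').isLeft ∧ ¬ Exposed B T δ h l a t' then (QueryTree.touching t' tr : ℝ) else 0) +
        if (l t').isLeft ∧ Exposed B T δ h l a t' then (X.card : ℝ) * D else 0) :=
        mul_le_mul_of_nonneg_left (Finset.sum_le_sum hYle) (Nat.cast_nonneg _)
    _ = _ := by
        rw [Finset.sum_add_distrib]
        congr 2
        rw [← Finset.sum_filter, Finset.sum_const, nsmul_eq_mul]
        ring

-- If there are at least `x` exposed rare terminals, or some class has more than `D` Steiner points,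
-- the trivial bound 1 is charged to the first or second term. Otherwise the collision count
-- applies.
open Classical in
theorem sum_min_suspicious_le (B : QueryTree V) (T : Finset V) (δ : ℝ) (h : ℕ) (hG : 0 < G)
    (hZ : 0 < Z) (l : V → Fin N ⊕ Fin M × Fin W) (a : V → Fin N) (D x : ℝ) (hD0 : 0 ≤ D)
    (hx : 0 < x) :
    ∑ g : Fin N → Fin G, min 1 (∑ s, if Suspicious T (B.trace (starDist T δ l a)) l g a s
        then 1 / (Z : ℝ) else 0) ≤
      Fintype.card (Fin N → Fin G) *
        (((T.filter fun t => (l t).isLeft ∧ Exposed B T δ h l a t).card : ℝ) / x +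
        (if ∃ b, D < ((Tᶜ.filter fun s => a s = b).card : ℝ) then 1 else 0) +
        ((∑ t ∈ T, if (l t).isLeft ∧ ¬ Exposed B T δ h l a t then
          (QueryTree.touching t (B.trace (starDist T δ l a)) : ℝ) else 0) + x ^ 2 * D) /
          (G * Z)) := by
  set E : ℝ := ((T.filter fun t => (l t).isLeft ∧ Exposed B T δ h l a t).card : ℝ) with hE
  set P : ℝ := ∑ t ∈ T, if (l t).isLeft ∧ ¬ Exposed B T δ h l a t then
          (QueryTree.touching t (B.trace (starDist T δ l a)) : ℝ) else 0 with hP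
  set S : (Fin N → Fin G) → ℝ := fun g => ((Finset.univ.filter fun s =>
        Suspicious T (B.trace (starDist T δ l a)) l g a s).card : ℝ) with hS
  have hE0 : 0 ≤ E := Nat.cast_nonneg _
  have hP0 : 0 ≤ P := Finset.sum_nonneg fun t _ => by positivity
  have hG' : (0 : ℝ) < G := by exact_mod_cast hG
  have hZ' : (0 : ℝ) < Z := by exact_mod_cast hZ
  have hPx : 0 ≤ (P + x ^ 2 * D) / (G * Z) := by positivity
  have hEx : 0 ≤ E / x := by positivity
  have hsum : ∀ g : Fin N → Fin G, (∑ s, if Suspicious T (B.trace (starDist T δ l a)) l g a s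
      then 1 / (Z : ℝ) else 0) = S g / Z := by
    intro g
    rw [← Finset.sum_filter, Finset.sum_const, nsmul_eq_mul, hS, mul_one_div]
  simp only [hsum]
  have htriv : ∀ c : ℝ, 1 ≤ c → ∑ g : Fin N → Fin G, min 1 (S g / Z) ≤
      Fintype.card (Fin N → Fin G) * c := by
    intro c hc
    calc ∑ g : Fin N → Fin G, min 1 (S g / Z) ≤ ∑ g : Fin N → Fin G, c :=
          Finset.sum_le_sum fun g _ => (min_le_left _ _).trans hc
      _ = _ := by rw [Finset.sum_const, Finset.card_univ, nsmul_eq_mul]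
  by_cases hdeg : ∃ b, D < ((Tᶜ.filter fun s => a s = b).card : ℝ)
  · rw [if_pos hdeg]
    exact htriv _ (by linarith)
  rw [if_neg hdeg, add_zero]
  by_cases hEl : x ≤ E
  · have : 1 ≤ E / x := by rwa [le_div_iff₀ hx, one_mul]
    exact htriv _ (by linarith)
  push Not at hdeg hEl
  have h1 := sum_card_suspicious_le (G := G) B T δ h l a D hdeg
  have h2 : E ^ 2 * D ≤ x ^ 2 * D :=
    mul_le_mul_of_nonneg_right (pow_le_pow_left₀ hE0 hEl.le 2) hD0
  calc ∑ g : Fin N → Fin G, min 1 (S g / Z) ≤ ∑ g : Fin N → Fin G, S g / Z :=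
        Finset.sum_le_sum fun g _ => min_le_right _ _
    _ = (G * ∑ g : Fin N → Fin G, S g) / (G * Z) := by
        rw [← Finset.sum_div]
        field_simp
    _ ≤ (Fintype.card (Fin N → Fin G) * (P + E ^ 2 * D)) / (G * Z) :=
        div_le_div_of_nonneg_right h1 (by positivity)
    _ ≤ (Fintype.card (Fin N → Fin G) * (P + x ^ 2 * D)) / (G * Z) := by gcongr
    _ = Fintype.card (Fin N → Fin G) * ((P + x ^ 2 * D) / (G * Z)) := by ring
    _ ≤ _ := mul_le_mul_of_nonneg_left (by linarith) (Nat.cast_nonneg _)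

end Collisions

/-! ### Tail bounds for random labels and Steiner data. -/

section Tails

variable {V : Type} [Fintype V] [DecidableEq V] {Λ : Type} [Fintype Λ] [DecidableEq Λ]

open Classical in
theorem card_avoid_le (S : Finset V) (x : Λ) :
    ((Finset.univ.filter fun f : V → Λ => ∀ v ∈ S, f v ≠ x).card : ℝ) ≤
      Real.exp (-(S.card / Fintype.card Λ)) * Fintype.card (V → Λ) := by
  have hpos : (0 : ℝ) < Fintype.card Λ := by exact_mod_cast Fintype.card_pos_iff.2 ⟨x⟩
  have h1 : (Finset.univ.filter fun f : V → Λ => ∀ v ∈ S, f v ≠ x) =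
      Fintype.piFinset fun v => if v ∈ S then Finset.univ.erase x else Finset.univ := by
    ext f
    simp only [Finset.mem_filter, Finset.mem_univ, true_and, Fintype.mem_piFinset]
    refine forall_congr' fun v => ?_
    by_cases hv : v ∈ S <;> simp [hv]
  rw [h1, Fintype.card_piFinset, Nat.cast_prod]
  calc ∏ v, ((if v ∈ S then Finset.univ.erase x else Finset.univ : Finset Λ).card : ℝ) ≤
      ∏ v : V, (if v ∈ S then Real.exp (-(1 / Fintype.card Λ)) else 1) * (Fintype.card Λ : ℝ) := by
        refine Finset.prod_le_prod (fun v _ => Nat.cast_nonneg _) fun v _ => ?_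
        split_ifs
        · rw [Finset.card_erase_of_mem (Finset.mem_univ _), Finset.card_univ,
            Nat.cast_sub (Fintype.card_pos_iff.2 ⟨x⟩)]
          have := Real.add_one_le_exp (-(1 / (Fintype.card Λ : ℝ)))
          calc ((Fintype.card Λ : ℝ) - (1 : ℕ)) =
              (-(1 / (Fintype.card Λ : ℝ)) + 1) * Fintype.card Λ := by
                field_simp; push_cast; ring
            _ ≤ _ := mul_le_mul_of_nonneg_right this hpos.le
        · simp
    _ = _ := by
        rw [Finset.prod_mul_distrib, Finset.prod_ite_mem, Finset.univ_inter, Finset.prod_const,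
          Finset.prod_const, ← Real.exp_nat_mul, Fintype.card_fun, Nat.cast_pow, Finset.card_univ]
        congr 2
        ring

open Classical in
/-- A Chernoff bound for the number of points of `S` with a given first coordinate. -/
theorem card_large_degree_le {N Z : ℕ} (S : Finset V) (D : ℕ) :
    ((Finset.univ.filter fun f : V → Fin N × Fin Z =>
        ∃ b, (D : ℝ) < ((S.filter fun s => (f s).1 = b).card : ℝ)).card : ℝ) ≤
      N * Real.exp (S.card / N) / 2 ^ D * Fintype.card (V → Fin N × Fin Z) := by
  -- The moment of `2 ^ degree` factors over the points, each point of `S` contributing `1 + 1 / N ≤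
  -- exp (1 / N)` on average. Markov's inequality and a union over the classes finish the proof.
  have hb : ∀ b : Fin N, ∑ f : V → Fin N × Fin Z, (2 : ℝ) ^ (S.filter fun s => (f s).1 = b).card ≤
      Real.exp (S.card / N) * Fintype.card (V → Fin N × Fin Z) := by
    intro b
    have hN : (0 : ℝ) < N := by exact_mod_cast b.pos
    have h1 : ∀ f : V → Fin N × Fin Z, (2 : ℝ) ^ (S.filter fun s => (f s).1 = b).card =
        ∏ v, if v ∈ S ∧ (f v).1 = b then (2 : ℝ) else 1 := by
      intro f
      rw [Finset.prod_ite, Finset.prod_const, Finset.prod_const_one, mul_one]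
      congr 2
      ext v
      simp
    simp only [h1]
    have h2 := Finset.prod_univ_sum (fun _ : V => (Finset.univ : Finset (Fin N × Fin Z)))
      fun v x => if v ∈ S ∧ x.1 = b then (2 : ℝ) else 1
    rw [Fintype.piFinset_univ] at h2
    rw [← h2]
    calc ∏ v : V, ∑ x : Fin N × Fin Z, (if v ∈ S ∧ x.1 = b then (2 : ℝ) else 1) ≤
        ∏ v : V, (if v ∈ S then Real.exp (1 / N) else 1) * ((N : ℝ) * Z) := by
          refine Finset.prod_le_prod (fun v _ => Finset.sum_nonneg fun x _ => by positivity)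
            fun v _ => ?_
          by_cases hv : v ∈ S
          · simp only [hv, true_and, if_true]
            have h3 : ∀ x : Fin N × Fin Z, (if x.1 = b then (2 : ℝ) else 1) =
                1 + if x.1 = b then 1 else 0 := fun x => by split_ifs <;> norm_num
            have h4 : ∑ x : Fin N × Fin Z, (if x.1 = b then (1 : ℝ) else 0) = Z := by
              rw [Fintype.sum_prod_type, Finset.sum_eq_single b]
              · simp
              · intro x _ hx
                simp [hx]
              · simp
            simp only [h3, Finset.sum_add_distrib, h4]
            simp only [Finset.sum_const, Finset.card_univ, Fintype.card_prod, Fintype.card_fin,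
              nsmul_eq_mul, mul_one, Nat.cast_mul]
            have := Real.add_one_le_exp (1 / (N : ℝ))
            calc (N : ℝ) * Z + Z = (1 / N + 1) * (N * Z) := by field_simp; ring
              _ ≤ _ := mul_le_mul_of_nonneg_right this (by positivity)
          · simp [hv]
      _ = _ := by
          rw [Finset.prod_mul_distrib, Finset.prod_ite_mem, Finset.univ_inter, Finset.prod_const,
            Finset.prod_const, ← Real.exp_nat_mul, Fintype.card_fun, Nat.cast_pow, Finset.card_univ,
            Fintype.card_prod, Fintype.card_fin, Fintype.card_fin, Nat.cast_mul]
          congr 2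
          ring
  have hpt : ∀ f : V → Fin N × Fin Z,
      (if ∃ b, (D : ℝ) < ((S.filter fun s => (f s).1 = b).card : ℝ) then (1 : ℝ) else 0) ≤
      ∑ b, (2 : ℝ) ^ (S.filter fun s => (f s).1 = b).card / 2 ^ D := by
    intro f
    split_ifs with hf
    · obtain ⟨b, hb⟩ := hf
      refine le_trans ?_ (Finset.single_le_sum
        (f := fun b => (2 : ℝ) ^ (S.filter fun s => (f s).1 = b).card / 2 ^ D)
        (fun b _ => by positivity) (Finset.mem_univ b))
      rw [le_div_iff₀ (by positivity), one_mul]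
      exact pow_le_pow_right₀ one_le_two (by exact_mod_cast hb.le)
    · exact Finset.sum_nonneg fun b _ => by positivity
  rw [← Finset.sum_boole]
  calc _ ≤ ∑ f : V → Fin N × Fin Z, ∑ b, (2 : ℝ) ^ (S.filter fun s => (f s).1 = b).card / 2 ^ D :=
        Finset.sum_le_sum fun f _ => hpt f
    _ = ∑ b, (∑ f : V → Fin N × Fin Z, (2 : ℝ) ^ (S.filter fun s => (f s).1 = b).card) / 2 ^ D := by
        rw [Finset.sum_comm]
        simp only [Finset.sum_div]
    _ ≤ ∑ b : Fin N, Real.exp (S.card / N) * Fintype.card (V → Fin N × Fin Z) / 2 ^ D :=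
        Finset.sum_le_sum fun b _ => div_le_div_of_nonneg_right (hb b) (by positivity)
    _ = _ := by
        rw [Finset.sum_const, Finset.card_univ, Fintype.card_fin, nsmul_eq_mul]
        ring

-- Markov's inequality for the number of rare labels that no terminal received.
open Classical in
theorem card_few_hit_le {N M W : ℕ} (hN : 0 < N) (T : Finset V) :
    ((Finset.univ.filter fun l : V → Fin N ⊕ Fin M × Fin W =>
        ((hitClasses T l).card : ℝ) < N / 2).card : ℝ) ≤
      2 * Real.exp (-(T.card / ((N : ℝ) + M * W))) *
        Fintype.card (V → Fin N ⊕ Fin M × Fin W) := by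
  have hN' : (0 : ℝ) < N := by exact_mod_cast hN
  have hpt : ∀ l : V → Fin N ⊕ Fin M × Fin W,
      (if ((hitClasses T l).card : ℝ) < N / 2 then (1 : ℝ) else 0) ≤
      (2 / N) * ∑ b : Fin N, if ∀ t ∈ T, l t ≠ Sum.inl b then (1 : ℝ) else 0 := by
    intro l
    have h1 : (∑ b : Fin N, if ∀ t ∈ T, l t ≠ Sum.inl b then (1 : ℝ) else 0) =
        N - (hitClasses T l).card := by
      rw [Finset.sum_boole, eq_sub_iff_add_eq, add_comm]
      have h2 := Finset.card_filter_add_card_filter_not (s := (Finset.univ : Finset (Fin N)))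
        (fun b => ∃ t ∈ T, l t = Sum.inl b)
      rw [Finset.card_univ, Fintype.card_fin] at h2
      simp only [not_exists, not_and] at h2
      exact_mod_cast h2
    rw [h1]
    have h0 : ((hitClasses T l).card : ℝ) ≤ N := by
      have := Finset.card_le_univ (hitClasses T l)
      rw [Fintype.card_fin] at this
      exact_mod_cast this
    split_ifs with hl
    · rw [div_mul_eq_mul_div, le_div_iff₀ hN']
      linarith
    · exact mul_nonneg (by positivity) (by linarith)
  rw [← Finset.sum_boole]
  refine (Finset.sum_le_sum fun l _ => hpt l).trans ?_
  rw [← Finset.mul_sum, Finset.sum_comm]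
  simp only [Finset.sum_boole]
  calc _ ≤ (2 / N) * ∑ b : Fin N, Real.exp (-(T.card / ((N : ℝ) + M * W))) *
        (Fintype.card (V → Fin N ⊕ Fin M × Fin W) : ℝ) := by
        refine mul_le_mul_of_nonneg_left (Finset.sum_le_sum fun b _ => ?_) (by positivity)
        have := card_avoid_le T (Sum.inl b : Fin N ⊕ Fin M × Fin W)
        simpa using this
    _ = _ := by
        rw [Finset.sum_const, Finset.card_univ, Fintype.card_fin, nsmul_eq_mul]
        field_simp

open Classical in
theorem card_many_uncovered_le {N G Z : ℕ} (hG : G ≤ N) (hZ : 0 < Z) (hN : 0 < N) (T : Finset V)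
    (g : Fin N → Fin G) (η : ℝ) (hη : 0 < η) :
    ((Finset.univ.filter fun f : V → Fin N × Fin Z =>
        η * N < ((uncovered T g f).card : ℝ)).card : ℝ) ≤
      Real.exp (-(Tᶜ.card / ((N : ℝ) * Z))) / η * Fintype.card (V → Fin N × Fin Z) := by
  have hN' : (0 : ℝ) < N := by exact_mod_cast hN
  -- The single value, among `N * Z`, that makes a Steiner point a centre of the group of `b`.
  let p : Fin N → Fin N × Fin Z := fun b => (Fin.castLE hG (g b), ⟨0, hZ⟩)
  have hp : ∀ (f : V → Fin N × Fin Z) b, (∀ s ∈ Tᶜ, ¬ (((f s).2 : ℕ) = 0 ∧ (g b : ℕ) = (f s).1)) ↔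
      ∀ s ∈ Tᶜ, f s ≠ p b := by
    intro f b
    refine forall₂_congr fun s _ => not_congr ?_
    rw [Prod.ext_iff, Fin.ext_iff, Fin.ext_iff]
    simp only [p, Fin.val_castLE]
    exact ⟨fun h => ⟨h.2.symm, h.1⟩, fun h => ⟨h.2, h.1.symm⟩⟩
  have hpt : ∀ f : V → Fin N × Fin Z,
      (if η * N < ((uncovered T g f).card : ℝ) then (1 : ℝ) else 0) ≤
      (1 / (η * N)) * ∑ b : Fin N, if ∀ s ∈ Tᶜ, f s ≠ p b then (1 : ℝ) else 0 := by
    intro f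
    have h1 : (∑ b : Fin N, if ∀ s ∈ Tᶜ, f s ≠ p b then (1 : ℝ) else 0) =
        (uncovered T g f).card := by
      rw [Finset.sum_boole]
      simp only [uncovered, hp]
    rw [h1]
    split_ifs with hl
    · rw [div_mul_eq_mul_div, le_div_iff₀ (by positivity)]
      linarith
    · positivity
  rw [← Finset.sum_boole]
  refine (Finset.sum_le_sum fun l _ => hpt l).trans ?_
  rw [← Finset.mul_sum, Finset.sum_comm]
  simp only [Finset.sum_boole]
  calc _ ≤ (1 / (η * N)) * ∑ b : Fin N, Real.exp (-(Tᶜ.card / ((N : ℝ) * Z))) *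
        (Fintype.card (V → Fin N × Fin Z) : ℝ) := by
        refine mul_le_mul_of_nonneg_left (Finset.sum_le_sum fun b _ => ?_) (by positivity)
        have := card_avoid_le Tᶜ (p b)
        simpa using this
    _ = _ := by
        rw [Finset.sum_const, Finset.card_univ, Fintype.card_fin, nsmul_eq_mul]
        field_simp

end Tails

/-! ### The superlinear bound with free parameters. -/

section GroupBound

variable {V : Type} [Fintype V] [DecidableEq V]

open Classical in
theorem card_filter_prod₃ {α β γ : Type} [Fintype α] [Fintype β] [Fintype γ]
    (p : α × β × γ → Prop) : ((Finset.univ.filter p).card : ℝ) =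
      ∑ x, ∑ y, ((Finset.univ.filter fun z => p (x, y, z)).card : ℝ) := by
  rw [← Finset.sum_boole, Fintype.sum_prod_type]
  refine Finset.sum_congr rfl fun x _ => ?_
  rw [Fintype.sum_prod_type]
  refine Finset.sum_congr rfl fun y _ => ?_
  rw [Finset.sum_boole]

open Classical in
/-- The average over all labels, groups and data of Steiner points of the advantage of an algorithm
that performs at most `Q` queries. -/
theorem advantage_le {N M W G Z h D : ℕ} (T : Finset V) (δ Q x : ℝ) (hG0 : 0 < G) (hG : G ≤ N)
    (hZ : 0 < Z) (hh : 0 < h) (hM : 2 * h ≤ M) (hN : N ≤ M * W) (hx : 0 < x) (B : QueryTree V)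
    (acc : (V → Fin N ⊕ Fin M × Fin W) → ℝ → Prop)
    (hB : ∀ (l : V → Fin N ⊕ Fin M × Fin W) (a : V → Fin N),
      (B.queries (starDist T δ l a) : ℝ) ≤ Q) :
    (∑ l : V → Fin N ⊕ Fin M × Fin W, ∑ _g : Fin N → Fin G,
      ((Finset.univ.filter fun f : V → Fin N × Fin Z =>
        acc l (B.output (starDist T δ l fun s => (f s).1))).card : ℝ)) -
      ∑ l : V → Fin N ⊕ Fin M × Fin W, ∑ g : Fin N → Fin G,
        ((Finset.univ.filter fun f : V → Fin N × Fin Z =>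
          acc l (B.output (groupDist T δ l g f))).card : ℝ) ≤
      (8 * ((N : ℝ) / h + 1) * Q / ((N : ℝ) + M * W) / x +
        N * Real.exp (Tᶜ.card / N) / 2 ^ D +
        (8 * N * Q / ((N : ℝ) + M * W) + x ^ 2 * D) / (G * Z)) *
      Fintype.card ((V → Fin N ⊕ Fin M × Fin W) × (Fin N → Fin G) × (V → Fin N × Fin Z)) := by
  have hpos : 0 < M * W := (hG0.trans_le hG).trans_le hN
  have hGZ : (0 : ℝ) < G * Z := by exact_mod_cast Nat.mul_pos hG0 hZ
  let E : (V → Fin N ⊕ Fin M × Fin W) → (V → Fin N × Fin Z) → ℝ := fun l f =>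
    ((T.filter fun t => (l t).isLeft ∧ Exposed B T δ h l (fun s => (f s).1) t).card : ℝ)
  let P : (V → Fin N ⊕ Fin M × Fin W) → (V → Fin N × Fin Z) → ℝ := fun l f =>
    ∑ t ∈ T, if (l t).isLeft ∧ ¬ Exposed B T δ h l (fun s => (f s).1) t then
      (QueryTree.touching t (B.trace (starDist T δ l fun s => (f s).1)) : ℝ) else 0
  let L : (V → Fin N × Fin Z) → ℝ := fun f =>
    if ∃ b, (D : ℝ) < ((Tᶜ.filter fun s => (f s).1 = b).card : ℝ) then 1 else 0
  set cL : ℝ := (Fintype.card (V → Fin N ⊕ Fin M × Fin W) : ℝ) with hcL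
  set cG : ℝ := (Fintype.card (Fin N → Fin G) : ℝ) with hcG
  set cF : ℝ := (Fintype.card (V → Fin N × Fin Z) : ℝ) with hcF
  set e : ℝ := 8 * ((N : ℝ) / h + 1) * Q / ((N : ℝ) + M * W) with he
  set p : ℝ := 8 * N * Q / ((N : ℝ) + M * W) with hp
  set d : ℝ := N * Real.exp (Tᶜ.card / N) / 2 ^ D with hd
  have hE : ∀ f, ∑ l, E l f ≤ e * cL := fun f =>
    sum_card_exposed_le B T δ h hh hM hN hpos _ Q fun l => hB l _
  have hP : ∀ f, ∑ l, P l f ≤ p * cL := fun f =>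
    sum_touching_unexposed_le B T δ h hM hN hpos _ Q fun l => hB l _
  have hL : ∑ f, L f ≤ d * cF := by
    have := card_large_degree_le (N := N) (Z := Z) Tᶜ D
    rw [← Finset.sum_boole] at this
    exact this
  rw [← Finset.sum_sub_distrib]
  calc _ ≤ ∑ l : V → Fin N ⊕ Fin M × Fin W, ∑ g : Fin N → Fin G, ∑ f : V → Fin N × Fin Z,
        min 1 (∑ s, if Suspicious T
          (B.trace (starDist T δ l fun s => (f s).1)) l g (fun s => (f s).1) s
          then 1 / (Z : ℝ) else 0) := by
        refine Finset.sum_le_sum fun l _ => ?_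
        rw [← Finset.sum_sub_distrib]
        exact Finset.sum_le_sum fun g _ =>
          card_accept_star_sub_group_le B T δ hG hZ l g (acc l)
    _ = ∑ l : V → Fin N ⊕ Fin M × Fin W, ∑ f : V → Fin N × Fin Z, ∑ g : Fin N → Fin G,
        min 1 (∑ s, if Suspicious T
          (B.trace (starDist T δ l fun s => (f s).1)) l g (fun s => (f s).1) s
          then 1 / (Z : ℝ) else 0) := Finset.sum_congr rfl fun l _ => Finset.sum_comm
    _ ≤ ∑ l : V → Fin N ⊕ Fin M × Fin W, ∑ f : V → Fin N × Fin Z,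
        cG * (E l f / x + L f + (P l f + x ^ 2 * D) / (G * Z)) :=
        Finset.sum_le_sum fun l _ => Finset.sum_le_sum fun f _ =>
          sum_min_suspicious_le B T δ h hG0 hZ l _ D x (Nat.cast_nonneg _) hx
    _ = cG * ((∑ f, ∑ l, E l f) / x + cL * ∑ f, L f +
          ((∑ f, ∑ l, P l f) + cL * cF * (x ^ 2 * D)) / (G * Z)) := by
        rw [Finset.sum_comm]
        simp only [← Finset.mul_sum, Finset.sum_add_distrib, ← Finset.sum_div, Finset.sum_const,
          Finset.card_univ, nsmul_eq_mul, ← hcL, ← hcF]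
        ring
    _ ≤ cG * ((∑ _f : V → Fin N × Fin Z, e * cL) / x + cL * (d * cF) +
          ((∑ _f : V → Fin N × Fin Z, p * cL) + cL * cF * (x ^ 2 * D)) / (G * Z)) := by
        have h1 := Finset.sum_le_sum fun f (_ : f ∈ Finset.univ) => hE f
        have h2 := Finset.sum_le_sum fun f (_ : f ∈ Finset.univ) => hP f
        gcongr
    _ = _ := by
        rw [Finset.sum_const, Finset.sum_const, Finset.card_univ, nsmul_eq_mul, nsmul_eq_mul,
          Fintype.card_prod, Fintype.card_prod, Nat.cast_mul, Nat.cast_mul]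
        ring

/-- In `hprob`, the two leading exponentials bound the bad pairs (too few rare classes hit, too many
uncovered), and the rest is the distinguishing advantage. `hcost` says that the costs of every other
pair are separated. -/
theorem group_lower_bound {Ω : Type*} [MeasurableSpace Ω] (μ : Measure Ω) [IsProbabilityMeasure μ]
    (A : RandomizedAlgorithm V Ω) (T : Finset V) (α : ℝ) (hα : 0 ≤ α) (hT : T.Nonempty)
    (hS : Tᶜ.Nonempty) (hA : A.Estimates μ T α) {N M W G Z h D : ℕ} (Q x η : ℝ) (hG0 : 0 < G)
    (hG : G ≤ N) (hZ : 0 < Z) (hh : 0 < h) (hM : 2 * h ≤ M) (hN : N ≤ M * W) (hx : 0 < x)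
    (hη : 0 < η)
    (hcost : ∀ H : ℝ, N / 2 ≤ H → α * (H + η * N + 2 * M + 2 * G + 1) < 2 * (H - 1))
    (hprob : 2 * Real.exp (-(T.card / ((N : ℝ) + M * W))) +
        Real.exp (-(Tᶜ.card / ((N : ℝ) * Z))) / η +
        (8 * ((N : ℝ) / h + 1) * Q / ((N : ℝ) + M * W) / x +
        N * Real.exp (Tᶜ.card / N) / 2 ^ D +
        (8 * N * Q / ((N : ℝ) + M * W) + x ^ 2 * D) / (G * Z)) < 1 / 3) :
    ∃ m : MetricSpace V, 0 < μ {ω | Q ≤ ((A.tree ω).queries m.dist : ℝ)} := by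
  classical
  have hN0 : 0 < N := hG0.trans_le hG
  have hk : (0 : ℝ) < T.card := by exact_mod_cast hT.card_pos
  have hk1 : (1 : ℝ) ≤ T.card := by exact_mod_cast hT.card_pos
  -- All short edges together then cost at most 1, which is the final summand 1 in `hcost`.
  set δ : ℝ := 1 / T.card with hδdef
  have hδ : 0 < δ := by positivity
  have hδ1 : δ ≤ 1 := by rwa [hδdef, div_le_one hk]
  have hδT : δ * T.card = 1 := by rw [hδdef]; field_simp
  obtain ⟨s0, hs0⟩ := hS
  have hV : Nonempty V := ⟨s0⟩
  let σ := (V → Fin N ⊕ Fin M × Fin W) × (Fin N → Fin G) × (V → Fin N × Fin Z)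
  let mN : σ → MetricSpace V := fun i => labelMetric T δ hδ hδ1 (fun u => labelClass (i.1 u))
    fun s y => y = Sum.inl (i.2.2 s).1
  let mY : σ → MetricSpace V := fun i => labelMetric T δ hδ hδ1 (fun u => labelClass (i.1 u))
    fun s y => groupAdj i.2.1 (i.2.2 s) y
  have hmN : ∀ i : σ, (mN i).dist = starDist T δ i.1 fun s => (i.2.2 s).1 := fun i => rfl
  have hmY : ∀ i : σ, (mY i).dist = groupDist T δ i.1 i.2.1 i.2.2 := fun i => rfl
  let few : σ → Prop := fun i => ((hitClasses T i.1).card : ℝ) < N / 2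
  let many : σ → Prop := fun i => η * N < ((uncovered T i.2.1 i.2.2).card : ℝ)
  let bad : Finset σ := Finset.univ.filter few ∪ Finset.univ.filter many
  have : Nonempty (Fin N → Fin G) := ⟨fun _ => ⟨0, hG0⟩⟩
  have : Nonempty (V → Fin N × Fin Z) := ⟨fun _ => (⟨0, hN0⟩, ⟨0, hZ⟩)⟩
  have : Nonempty (V → Fin N ⊕ Fin M × Fin W) := ⟨fun _ => Sum.inl ⟨0, hN0⟩⟩
  have hσ : (0 : ℝ) < Fintype.card σ := by exact_mod_cast Fintype.card_pos
  have hσmul : (Fintype.card σ : ℝ) = Fintype.card (V → Fin N ⊕ Fin M × Fin W) *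
      (Fintype.card (Fin N → Fin G) * Fintype.card (V → Fin N × Fin Z)) := by
    rw [Fintype.card_prod, Fintype.card_prod, Nat.cast_mul, Nat.cast_mul]
  refine exists_metric_of_indistinguishable μ A T α hA mN mY
    (fun i => 2 * (((hitClasses T i.1).card : ℝ) - 1)) ?_ bad ?_ Q
    ((8 * ((N : ℝ) / h + 1) * Q / ((N : ℝ) + M * W) / x +
        N * Real.exp (Tᶜ.card / N) / 2 ^ D +
        (8 * N * Q / ((N : ℝ) + M * W) + x ^ 2 * D) / (G * Z)) * Fintype.card σ) ?_ ?_
  · exact fun i => le_steinerCost_star T δ hδ hδ1 i.1 _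
  · intro i hi
    simp only [bad, few, many, Finset.mem_union, Finset.mem_filter, Finset.mem_univ, true_and,
      not_or, not_lt] at hi
    refine lt_of_le_of_lt (mul_le_mul_of_nonneg_left ?_ hα) (hcost _ hi.1)
    have := steinerCost_group_le T ⟨s0, hs0⟩ δ hδ hδ1 i.1 i.2.1 i.2.2
    rw [hδT] at this
    refine this.trans ?_
    linarith [hi.2]
  · intro B hB
    have hB' : ∀ (l : V → Fin N ⊕ Fin M × Fin W) (a : V → Fin N),
        (B.queries (starDist T δ l a) : ℝ) ≤ Q := by
      intro l a
      have := hB (l, fun _ => ⟨0, hG0⟩, fun s => (a s, ⟨0, hZ⟩))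
      rw [hmN] at this
      exact this.le
    have := advantage_le (D := D) T δ Q x hG0 hG hZ hh hM hN hx B
      (fun l r => 2 * (((hitClasses T l).card : ℝ) - 1) ≤ r) hB'
    simp only [hmN, hmY]
    rw [card_filter_prod₃, card_filter_prod₃]
    exact this
  · have hfew : ((Finset.univ.filter few).card : ℝ) ≤
        2 * Real.exp (-(T.card / ((N : ℝ) + M * W))) * Fintype.card σ := by
      rw [← Finset.sum_boole, Fintype.sum_prod_type, hσmul]
      have := card_few_hit_le (M := M) (W := W) hN0 T
      rw [← Finset.sum_boole] at this
      calc _ = ∑ l : V → Fin N ⊕ Fin M × Fin W,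
            (Fintype.card (Fin N → Fin G) * Fintype.card (V → Fin N × Fin Z) : ℝ) *
              (if ((hitClasses T l).card : ℝ) < N / 2 then 1 else 0) := by
            refine Finset.sum_congr rfl fun l _ => ?_
            change (∑ _y : (Fin N → Fin G) × (V → Fin N × Fin Z),
              if ((hitClasses T l).card : ℝ) < N / 2 then (1 : ℝ) else 0) = _
            rw [Finset.sum_const, Finset.card_univ, nsmul_eq_mul, Fintype.card_prod, Nat.cast_mul]
        _ = (Fintype.card (Fin N → Fin G) * Fintype.card (V → Fin N × Fin Z) : ℝ) *
              ∑ l : V → Fin N ⊕ Fin M × Fin W,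
                (if ((hitClasses T l).card : ℝ) < N / 2 then 1 else 0) := by
            rw [Finset.mul_sum]
        _ ≤ (Fintype.card (Fin N → Fin G) * Fintype.card (V → Fin N × Fin Z) : ℝ) *
            (2 * Real.exp (-(T.card / ((N : ℝ) + M * W))) *
              Fintype.card (V → Fin N ⊕ Fin M × Fin W)) :=
            mul_le_mul_of_nonneg_left this (by positivity)
        _ = _ := by ring
    have hmany : ((Finset.univ.filter many).card : ℝ) ≤
        Real.exp (-(Tᶜ.card / ((N : ℝ) * Z))) / η * Fintype.card σ := by
      rw [card_filter_prod₃, hσmul]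
      calc _ ≤ ∑ _l : V → Fin N ⊕ Fin M × Fin W, ∑ _g : Fin N → Fin G,
            Real.exp (-(Tᶜ.card / ((N : ℝ) * Z))) / η *
              (Fintype.card (V → Fin N × Fin Z) : ℝ) :=
            Finset.sum_le_sum fun l _ => Finset.sum_le_sum fun g _ =>
              card_many_uncovered_le hG hZ hN0 T g η hη
        _ = _ := by
            simp only [Finset.sum_const, Finset.card_univ, nsmul_eq_mul]
            ring
    have hbad : (bad.card : ℝ) ≤ (Finset.univ.filter few).card + (Finset.univ.filter many).card := by
      exact_mod_cast Finset.card_union_le _ _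
    have := mul_lt_mul_of_pos_right hprob hσ
    linarith

end GroupBound

/-! ### Choice of parameters. -/

section Parameters

theorem exp_neg_five_le : Real.exp (-5) ≤ 1 / 32 := by
  rw [Real.exp_neg, ← one_div]
  refine one_div_le_one_div_of_le (by norm_num) ?_
  have h1 : (2 : ℝ) ≤ Real.exp 1 := by linarith [Real.add_one_le_exp (1 : ℝ)]
  calc (32 : ℝ) = 2 ^ 5 := by norm_num
    _ ≤ Real.exp 1 ^ 5 := pow_le_pow_left₀ zero_le_two h1 5
    _ = Real.exp 5 := by rw [← Real.exp_nat_mul]; norm_num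

/-- Since `log 2 > 1 / 2`, the denominator is at least `exp (2 * u)`, and `exp u ≥ u ^ 2 / 2`. -/
theorem exp_div_two_pow_le {u : ℝ} (hu : 0 < u) {D : ℕ} (hD : 4 * u ≤ D) :
    Real.exp u / 2 ^ D ≤ 2 / u ^ 2 := by
  have h1 : Real.exp (2 * u) ≤ 2 ^ D := by
    have h2 : (2 : ℝ) ^ D = Real.exp (D * Real.log 2) := by
      rw [Real.exp_nat_mul, Real.exp_log two_pos]
    rw [h2]
    refine Real.exp_le_exp.2 ?_
    nlinarith [Real.log_two_gt_d9]
  have h3 : u ^ 2 / 2 ≤ Real.exp u := by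
    have := Real.quadratic_le_exp_of_nonneg hu.le
    linarith
  have h4 : Real.exp (2 * u) = Real.exp u * Real.exp u := by rw [two_mul, Real.exp_add]
  rw [div_le_div_iff₀ (by positivity) (by positivity)]
  have h5 := Real.exp_pos u
  calc Real.exp u * u ^ 2 ≤ Real.exp u * (2 * Real.exp u) :=
        mul_le_mul_of_nonneg_left (by linarith) h5.le
    _ = 2 * Real.exp (2 * u) := by rw [h4]; ring
    _ ≤ 2 * 2 ^ D := by linarith

theorem half_le_floor {u : ℝ} (hu : 1 ≤ u) : u / 2 ≤ (⌊u⌋₊ : ℝ) := by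
  have h1 := Nat.lt_floor_add_one u
  have h2 : (1 : ℝ) ≤ (⌊u⌋₊ : ℝ) := by exact_mod_cast Nat.le_floor (by exact_mod_cast hu)
  linarith

theorem cost_gap {ε N M H : ℝ} (hε : 0 < ε) (hNM : 64 * M ≤ N * ε) (hM : 1 ≤ M)
    (hH : N / 2 ≤ H) : (2 - ε) * (H + ε / 16 * N + 2 * M + 2 * M + 1) < 2 * (H - 1) := by
  have hHε : N / 2 * ε ≤ H * ε := mul_le_mul_of_nonneg_right hH hε.le
  have hX : 0 ≤ ε * (N * ε / 16 + 4 * M + 1) := mul_nonneg hε.le (by linarith)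
  calc (2 - ε) * (H + ε / 16 * N + 2 * M + 2 * M + 1)
      = 2 * H + 2 * (N * ε / 16 + 4 * M + 1) - H * ε - ε * (N * ε / 16 + 4 * M + 1) := by ring
    _ < _ := by linarith

set_option maxHeartbeats 1000000 in
/-- Parameters for which `group_lower_bound` gives `y ^ 6` queries, for at least `y ^ 5` terminals
and `y` large. -/
theorem exists_group_parameters (ε : ℝ) (hε : 0 < ε) (hε1 : ε < 1) :
    ∃ (y₀ : ℕ) (η : ℝ), 0 < η ∧ ∀ y : ℕ, y₀ ≤ y → ∀ k s : ℝ, (y : ℝ) ^ 5 ≤ k → k ≤ s →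
      ∃ (N M W Z h D : ℕ) (x : ℝ), 0 < M ∧ M ≤ N ∧ 0 < Z ∧ 0 < h ∧ 2 * h ≤ M ∧ N ≤ M * W ∧ 0 < x ∧
        (∀ H : ℝ, N / 2 ≤ H → (2 - ε) * (H + η * N + 2 * M + 2 * M + 1) < 2 * (H - 1)) ∧
        2 * Real.exp (-(k / ((N : ℝ) + M * W))) + Real.exp (-(s / ((N : ℝ) * Z))) / η +
          (8 * ((N : ℝ) / h + 1) * (y : ℝ) ^ 6 / ((N : ℝ) + M * W) / x +
          N * Real.exp (s / N) / 2 ^ D +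
          (8 * N * (y : ℝ) ^ 6 / ((N : ℝ) + M * W) + x ^ 2 * D) / (M * Z)) < 1 / 3 := by
  set η : ℝ := ε / 16 with hη
  have hη0 : 0 < η := by positivity
  -- `d` is the ratio of rare to frequent classes, large enough to make the terms `2 * M` in the
  -- cost negligible. `C` is a lower bound for the expected number of centres per group.
  obtain ⟨d, hd⟩ := exists_nat_ge (64 / ε)
  obtain ⟨C, hC⟩ := exists_nat_ge (20 / η)
  have hd64 : (64 : ℝ) ≤ d := by
    refine le_trans ?_ hd
    rw [le_div_iff₀ hε]
    linarith
  have hC1 : (1 : ℝ) ≤ C := by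
    refine le_trans ?_ hC
    rw [le_div_iff₀ hη0, hη]
    linarith
  have hdε : 64 ≤ d * ε := by rwa [div_le_iff₀ hε] at hd
  have hCη : 20 ≤ C * η := by rwa [div_le_iff₀ hη0] at hC
  obtain ⟨c₁, hc₁n⟩ : ∃ c₁ : ℕ, c₁ = 3200 * (2 * d + 1) := ⟨_, rfl⟩
  -- The threshold dominates `100 * C * c₁ ^ 2`, `12800 * C * d ^ 2` and `320 * d ^ 3`, which the
  -- errors of order `1 / y` in `h7`, `h6` and `h4` require.
  refine ⟨100 * C * c₁ ^ 2 * d, η, hη0, ?_⟩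
  intro y hy k s hk5 hks
  have hd0 : 0 < d := by exact_mod_cast (by linarith : (0 : ℝ) < d)
  have hC0 : 0 < C := by exact_mod_cast (by linarith : (0 : ℝ) < C)
  have hc₁ : (c₁ : ℝ) = 3200 * (2 * d + 1) := by rw [hc₁n]; push_cast; ring
  have hc₁d : (6400 : ℝ) * d ≤ c₁ := by rw [hc₁]; linarith
  have hc₁1 : (6400 : ℝ) ≤ c₁ := by linarith
  have hy' : 100 * (C : ℝ) * c₁ ^ 2 * d ≤ y := by exact_mod_cast hy
  have hy1 : 100 * (C : ℝ) * c₁ ^ 2 ≤ y := by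
    refine le_trans (le_mul_of_one_le_right (by positivity) (by linarith)) hy'
  have hc₁sq : (6400 : ℝ) ^ 2 * d ^ 2 ≤ c₁ ^ 2 := by
    rw [← mul_pow]
    exact pow_le_pow_left₀ (by positivity) hc₁d 2
  have hy2 : 12800 * (C : ℝ) * d ^ 2 ≤ y := by
    refine le_trans ?_ hy1
    have : 12800 * (d : ℝ) ^ 2 ≤ 100 * c₁ ^ 2 := by nlinarith [sq_nonneg (d : ℝ)]
    nlinarith
  have hy3 : 320 * (d : ℝ) ^ 3 ≤ y := by
    refine le_trans ?_ hy'
    have h1 : 320 * (d : ℝ) ^ 2 ≤ 100 * C * c₁ ^ 2 := by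
      have : 320 * (d : ℝ) ^ 2 ≤ 100 * c₁ ^ 2 := by nlinarith [sq_nonneg (d : ℝ)]
      nlinarith [sq_nonneg (c₁ : ℝ)]
    calc 320 * (d : ℝ) ^ 3 = 320 * (d : ℝ) ^ 2 * d := by ring
      _ ≤ _ := mul_le_mul_of_nonneg_right h1 (by linarith)
  have hY1 : (1 : ℝ) ≤ y := by nlinarith [pow_le_pow_left₀ (by linarith) hd64 3]
  have hY0 : (0 : ℝ) < y := by linarith
  have hsq : (y : ℝ) ≤ y ^ 2 := le_self_pow₀ hY1 two_ne_zero
  have hyCd : 40 * (C * d) ≤ (y : ℝ) ^ 2 := by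
    refine le_trans ?_ (hy2.trans hsq)
    have : (0 : ℝ) ≤ C * d := by positivity
    nlinarith
  have hyd : 40 * (d : ℝ) ≤ (y : ℝ) ^ 2 := by nlinarith
  have hyn : 0 < y := by exact_mod_cast hY0
  have hs5 : (y : ℝ) ^ 5 ≤ s := hk5.trans hks
  have hk0 : 0 < k := lt_of_lt_of_le (by positivity) hk5
  have hs0 : 0 < s := by linarith
  -- `M` also serves as the number of groups, and the query budget is `h = y ^ 3 = M / 2`. The total
  -- number of labels is between `k / 20` and `k / 5`, so most rare classes are hit. The exposed
  -- rare terminals number `O(y)` on average, and `x = c₁ * y` is chosen to make their Markov term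
  -- at most `1 / 20`.
  obtain ⟨M, hM⟩ : ∃ M : ℕ, M = 2 * y ^ 3 := ⟨_, rfl⟩
  obtain ⟨N, hN⟩ : ∃ N : ℕ, N = d * M := ⟨_, rfl⟩
  obtain ⟨W, hW⟩ : ∃ W : ℕ, W = ⌊k / (10 * M)⌋₊ := ⟨_, rfl⟩
  obtain ⟨Z, hZ⟩ : ∃ Z : ℕ, Z = ⌊s / (C * N)⌋₊ := ⟨_, rfl⟩
  obtain ⟨D, hD⟩ : ∃ D : ℕ, D = ⌈4 * (s / N)⌉₊ := ⟨_, rfl⟩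
  have hMr : (M : ℝ) = 2 * (y : ℝ) ^ 3 := by simp [hM]
  have hNM : (N : ℝ) = d * M := by simp [hN]
  have hNr : (N : ℝ) = 2 * d * (y : ℝ) ^ 3 := by rw [hNM, hMr]; ring
  have hM0 : (0 : ℝ) < M := by rw [hMr]; positivity
  have hN0 : (0 : ℝ) < N := by rw [hNr]; positivity
  have hy5 : (y : ℝ) ^ 5 = y ^ 2 * y ^ 3 := by ring
  have hy3pos : (0 : ℝ) < (y : ℝ) ^ 3 := by positivity
  have hNk : 20 * (N : ℝ) ≤ k := by
    refine le_trans ?_ hk5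
    rw [hNr, hy5]
    calc 20 * (2 * d * (y : ℝ) ^ 3) = 40 * d * (y : ℝ) ^ 3 := by ring
      _ ≤ _ := mul_le_mul_of_nonneg_right hyd hy3pos.le
  have hMN : (64 : ℝ) * M ≤ N := by
    rw [hNM]
    exact mul_le_mul_of_nonneg_right hd64 hM0.le
  have hWle : (M : ℝ) * W ≤ k / 10 := by
    have h1 : (W : ℝ) ≤ k / (10 * M) := hW ▸ Nat.floor_le (by positivity)
    calc (M : ℝ) * W ≤ M * (k / (10 * M)) := mul_le_mul_of_nonneg_left h1 hM0.le
      _ = k / 10 := by field_simp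
  have hWge : k / 20 ≤ (M : ℝ) * W := by
    have h1 : k / (10 * M) / 2 ≤ (W : ℝ) := hW ▸ half_le_floor (by
      rw [le_div_iff₀ (by positivity)]
      linarith)
    calc k / 20 = M * (k / (10 * M) / 2) := by field_simp; norm_num
      _ ≤ _ := mul_le_mul_of_nonneg_left h1 hM0.le
  have hNMW : (N : ℝ) ≤ M * W := by linarith
  set K : ℝ := (N : ℝ) + M * W with hK
  have hK0 : 0 < K := by linarith
  have hKlow : (y : ℝ) ^ 5 / 20 ≤ K := by linarith
  have hKup : K ≤ k / 5 := by linarith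
  have hCN : (C : ℝ) * N ≤ s := by
    refine le_trans ?_ hs5
    rw [hNr, hy5]
    have : (0 : ℝ) ≤ C * d := by positivity
    calc (C : ℝ) * (2 * d * (y : ℝ) ^ 3) = 2 * (C * d) * (y : ℝ) ^ 3 := by ring
      _ ≤ _ := mul_le_mul_of_nonneg_right (by linarith) hy3pos.le
  have hu1 : 1 ≤ s / (C * N) := by
    rw [le_div_iff₀ (by positivity)]
    linarith
  have hZge : s / (C * N) / 2 ≤ (Z : ℝ) := hZ ▸ half_le_floor hu1
  have hZle : (Z : ℝ) ≤ s / (C * N) := hZ ▸ Nat.floor_le (by positivity)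
  have hZ0 : (0 : ℝ) < Z := lt_of_lt_of_le (by positivity) hZge
  have hGZ : s / (2 * C * d) ≤ (M : ℝ) * Z := by
    calc s / (2 * C * d) = M * (s / (C * N) / 2) := by
          rw [hNr, hMr]; field_simp
      _ ≤ _ := mul_le_mul_of_nonneg_left hZge hM0.le
  have hDge : 4 * (s / N) ≤ (D : ℝ) := hD ▸ Nat.le_ceil _
  have hsN : 1 ≤ s / N := by
    rw [le_div_iff₀ hN0, one_mul]
    linarith
  have hDle : (D : ℝ) ≤ 5 * (s / N) := by
    have := Nat.ceil_lt_add_one (a := 4 * (s / N)) (by positivity)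
    rw [← hD] at this
    linarith
  have hQK : (y : ℝ) ^ 6 / K ≤ 20 * y := by
    rw [div_le_iff₀ hK0]
    calc (y : ℝ) ^ 6 = 20 * y * ((y : ℝ) ^ 5 / 20) := by ring
      _ ≤ _ := mul_le_mul_of_nonneg_left hKlow (by positivity)
  have hNh : (N : ℝ) / ((y ^ 3 : ℕ) : ℝ) = 2 * d := by
    rw [hNr]; push_cast; field_simp
  refine ⟨N, M, W, Z, y ^ 3, D, c₁ * y, by exact_mod_cast hM0,
    by exact_mod_cast (by linarith : (M : ℝ) ≤ N), by exact_mod_cast hZ0, by positivity, hM.ge,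
    by exact_mod_cast hNMW, by positivity, ?_, ?_⟩
  · intro H hH
    have hM8 : 64 * (M : ℝ) ≤ N * ε := by
      rw [hNM, mul_right_comm]
      exact mul_le_mul_of_nonneg_right hdε hM0.le
    have hM1 : (1 : ℝ) ≤ M := by exact_mod_cast (by exact_mod_cast hM0 : 0 < M)
    exact cost_gap hε hM8 hM1 hH
  · have h1 : 2 * Real.exp (-(k / K)) ≤ 1 / 16 := by
      have : (5 : ℝ) ≤ k / K := by
        rw [le_div_iff₀ hK0]
        linarith
      have h2 : Real.exp (-(k / K)) ≤ Real.exp (-5) := Real.exp_le_exp.2 (by linarith)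
      linarith [exp_neg_five_le]
    have h2 : Real.exp (-(s / (N * Z))) / η ≤ 1 / 20 := by
      have h3 : (C : ℝ) ≤ s / (N * Z) := by
        rw [le_div_iff₀ (by positivity)]
        rw [le_div_iff₀ (by positivity)] at hZle
        linarith
      have h4 : C ≤ Real.exp (s / (N * Z)) := by
        linarith [Real.add_one_le_exp (s / (N * Z))]
      rw [Real.exp_neg, inv_eq_one_div, div_div]
      refine one_div_le_one_div_of_le (by norm_num) ?_
      exact hCη.trans (mul_le_mul_of_nonneg_right h4 hη0.le)
    have h3 : 8 * ((N : ℝ) / ((y ^ 3 : ℕ) : ℝ) + 1) * (y : ℝ) ^ 6 / K / (c₁ * y) ≤ 1 / 20 := by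
      rw [hNh, div_le_iff₀ (by positivity), hc₁]
      calc 8 * (2 * (d : ℝ) + 1) * (y : ℝ) ^ 6 / K = 8 * (2 * (d : ℝ) + 1) * ((y : ℝ) ^ 6 / K) := by
            ring
        _ ≤ 8 * (2 * (d : ℝ) + 1) * (20 * y) := mul_le_mul_of_nonneg_left hQK (by positivity)
        _ = _ := by ring
    have h4 : N * Real.exp (s / N) / 2 ^ D ≤ 1 / 20 := by
      have h5 := exp_div_two_pow_le (by positivity) hDge
      calc N * Real.exp (s / N) / 2 ^ D = N * (Real.exp (s / N) / 2 ^ D) := by ring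
        _ ≤ N * (2 / (s / N) ^ 2) := mul_le_mul_of_nonneg_left h5 hN0.le
        _ = 2 * (N : ℝ) ^ 3 / s ^ 2 := by field_simp
        _ ≤ 2 * (N : ℝ) ^ 3 / ((y : ℝ) ^ 5) ^ 2 := by gcongr
        _ = 16 * d ^ 3 / y := by rw [hNr]; field_simp; ring
        _ ≤ 1 / 20 := by
          rw [div_le_iff₀ hY0]
          linarith
    have h5 : (8 * (N : ℝ) * (y : ℝ) ^ 6 / K + (c₁ * y) ^ 2 * D) / (M * Z) ≤ 1 / 10 := by
      have h6 : 8 * (N : ℝ) * (y : ℝ) ^ 6 / K ≤ s / (2 * C * d) / 20 := by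
        calc 8 * (N : ℝ) * (y : ℝ) ^ 6 / K = 8 * (N : ℝ) * ((y : ℝ) ^ 6 / K) := by ring
          _ ≤ 8 * (N : ℝ) * (20 * y) := mul_le_mul_of_nonneg_left hQK (by positivity)
          _ = 320 * (d : ℝ) * (y : ℝ) ^ 4 := by rw [hNr]; ring
          _ = 12800 * (C : ℝ) * d ^ 2 * (y : ℝ) ^ 4 / (40 * C * d) := by field_simp; norm_num
          _ ≤ y * (y : ℝ) ^ 4 / (40 * C * d) := by gcongr
          _ = (y : ℝ) ^ 5 / (2 * C * d) / 20 := by field_simp; norm_num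
          _ ≤ _ := by gcongr
      have h7 : (c₁ * (y : ℝ)) ^ 2 * D ≤ s / (2 * C * d) / 20 := by
        calc (c₁ * (y : ℝ)) ^ 2 * D ≤ (c₁ * (y : ℝ)) ^ 2 * (5 * (s / N)) :=
              mul_le_mul_of_nonneg_left hDle (by positivity)
          _ = (100 * C * c₁ ^ 2) * (s / (2 * C * d) / 20) / y := by
              rw [hNr]; field_simp; norm_num
          _ ≤ y * (s / (2 * C * d) / 20) / y := by gcongr
          _ = _ := by field_simp
      rw [div_le_iff₀ (by positivity)]
      linarith
    rw [← hK]
    linarith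

end Parameters

/-! ### The superlinear bound and its combination with the linear one. -/

/-- For `k ≥ y ^ 5` terminals and at least as many Steiner points, `y ^ 6` queries are needed once
`y` is large. -/
theorem superlinear_lower_bound (ε : ℝ) (hε : 0 < ε) (hε1 : ε < 1) :
    ∃ y₀ : ℕ, ∀ y : ℕ, y₀ ≤ y → 0 < y → ∀ {V : Type} [Fintype V] [DecidableEq V] {Ω : Type*}
      [MeasurableSpace Ω] (μ : Measure Ω) [IsProbabilityMeasure μ] (A : RandomizedAlgorithm V Ω)
      (T : Finset V), y ^ 5 ≤ T.card → T.card ≤ Tᶜ.card → A.Estimates μ T (2 - ε) →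
      ∃ m : MetricSpace V, 0 < μ {ω | (y : ℝ) ^ 6 ≤ ((A.tree ω).queries m.dist : ℝ)} := by
  obtain ⟨y₀, η, hη, hy₀⟩ := exists_group_parameters ε hε hε1
  refine ⟨y₀, fun y hy hy1 V _ _ Ω _ μ _ A T hyk hST hA => ?_⟩
  obtain ⟨N, M, W, Z, h, D, x, hM0, hMN, hZ, hh, hhM, hN, hx, hcost, hprob⟩ :=
    hy₀ y hy T.card Tᶜ.card (by exact_mod_cast hyk) (by exact_mod_cast hST)
  have hT : 0 < T.card := lt_of_lt_of_le (by positivity) hyk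
  exact group_lower_bound μ A T (2 - ε) (by linarith) (Finset.card_pos.1 hT)
    (Finset.card_pos.1 (hT.trans_le hST)) hA _ x η hM0 hMN hZ hh hhM hN hx hη hcost hprob

end SteinerQuery

theorem theorem1p4 (ε : ℝ) (hε : 0 < ε) (hε' : ε < 1 / 3) :
    ∃ c : ℝ, 0 < c ∧ ∃ C : ℕ,
      ∀ (n k : ℕ), 2 / ε < (k : ℝ) → 2 * k < n →
      ∀ T : Finset (Fin n), T.card = k →
      ∀ (Ω : Type*) [MeasurableSpace Ω] (μ : Measure Ω) [IsProbabilityMeasure μ]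
        (A : SteinerQuery.RandomizedAlgorithm (Fin n) Ω),
        A.Estimates μ T (2 - ε) →
        ∃ m : MetricSpace (Fin n),
          0 < μ {ω | c * ((n : ℝ) + (k : ℝ) ^ (6 / 5 : ℝ)) / Real.log n ^ C ≤
            ((A.tree ω).queries m.dist : ℝ)} := by
  obtain ⟨y₀, hy₀⟩ := SteinerQuery.superlinear_lower_bound ε hε (by linarith)
  -- The exponent of the logarithm is 0. In 128, a factor 64 pays for rounding `k ^ (1/5)` down to
  -- `y`, and a factor 2 for `n + p ≤ 2 * p`. The factor `1 + y₀` covers small `k` in the linear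
  -- case.
  refine ⟨1 / (128 * (1 + y₀)), by positivity, 0, ?_⟩
  intro n k hk hkn T hT Ω _ μ _ A hA
  have hnr : 2 * (k : ℝ) < n := by exact_mod_cast hkn
  have hk0 : (0 : ℝ) < k := lt_trans (by positivity) hk
  have hTc : Tᶜ.card = n - k := by rw [Finset.card_compl, Fintype.card_fin, hT]
  have hTcr : (Tᶜ.card : ℝ) = n - k := by
    rw [hTc, Nat.cast_sub (by omega)]
  have hy0 : (0 : ℝ) ≤ y₀ := Nat.cast_nonneg _
  have hlin := SteinerQuery.linear_lower_bound μ A T (2 - ε) (by linarith) (by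
    rw [hT]
    rw [div_lt_iff₀ hε] at hk
    linarith) (Finset.card_pos.1 (by omega)) hA
  rw [hTcr] at hlin
  set p : ℝ := (k : ℝ) ^ (6 / 5 : ℝ) with hp
  have hp0 : 0 ≤ p := by positivity
  have hmono : ∀ Q : ℝ, 1 / (128 * (1 + (y₀ : ℝ))) * ((n : ℝ) + p) ≤ Q →
      (∃ m : MetricSpace (Fin n), 0 < μ {ω | Q ≤ ((A.tree ω).queries m.dist : ℝ)}) →
      ∃ m : MetricSpace (Fin n), 0 < μ {ω | 1 / (128 * (1 + (y₀ : ℝ))) * ((n : ℝ) + p) /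
        Real.log n ^ 0 ≤ ((A.tree ω).queries m.dist : ℝ)} := by
    rintro Q hQ ⟨m, hm⟩
    refine ⟨m, hm.trans_le (measure_mono fun ω hω => ?_)⟩
    simp only [pow_zero, div_one]
    exact hQ.trans hω
  let y : ℕ := ⌊(k : ℝ) ^ (1 / 5 : ℝ)⌋₊
  have hroot0 : (0 : ℝ) ≤ (k : ℝ) ^ (1 / 5 : ℝ) := by positivity
  have hroot5 : ((k : ℝ) ^ (1 / 5 : ℝ)) ^ 5 = k := by
    rw [← Real.rpow_natCast, ← Real.rpow_mul hk0.le]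
    norm_num
  have hroot6 : ((k : ℝ) ^ (1 / 5 : ℝ)) ^ 6 = p := by
    rw [← Real.rpow_natCast, ← Real.rpow_mul hk0.le]
    norm_num [hp]
  have hyle : (y : ℝ) ≤ (k : ℝ) ^ (1 / 5 : ℝ) := Nat.floor_le hroot0
  have hylt : (k : ℝ) ^ (1 / 5 : ℝ) < y + 1 := Nat.lt_floor_add_one _
  -- The superlinear bound is needed only when `p` dominates and `y` is large. Otherwise `p` is at
  -- most `(1 + y₀) * n`, and the linear bound suffices because `n - k > n / 2`.
  by_cases hy : y₀ ≤ y ∧ (n : ℝ) ≤ p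
  · have h1 : 1 ≤ y := by
      refine Nat.le_floor ?_
      have : (1 : ℝ) ≤ k := by exact_mod_cast (by exact_mod_cast hk0 : 0 < k)
      simpa using Real.one_le_rpow this (by norm_num)
    refine hmono _ ?_ (hy₀ y hy.1 h1 μ A T ?_ (by omega) hA)
    · have h1' : (1 : ℝ) ≤ y := by exact_mod_cast h1
      have h2 : p ≤ 64 * (y : ℝ) ^ 6 := by
        rw [← hroot6]
        calc ((k : ℝ) ^ (1 / 5 : ℝ)) ^ 6 ≤ (2 * (y : ℝ)) ^ 6 :=
              pow_le_pow_left₀ hroot0 (by linarith) 6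
          _ = _ := by ring
      rw [div_mul_eq_mul_div, one_mul, div_le_iff₀ (by positivity)]
      have h3 : (0 : ℝ) ≤ (y : ℝ) ^ 6 * y₀ := by positivity
      nlinarith [hy.2]
    · rw [hT]
      have h4 : (y : ℝ) ^ 5 ≤ k := by
        rw [← hroot5]
        exact pow_le_pow_left₀ (Nat.cast_nonneg _) hyle 5
      exact_mod_cast h4
  · refine hmono _ ?_ hlin
    have h1 : p ≤ (1 + y₀) * n := by
      rw [not_and_or, not_le, not_le] at hy
      rcases hy with hy | hy
      · have h2 : (y : ℝ) + 1 ≤ y₀ := by exact_mod_cast hy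
        rw [← hroot6, pow_succ, hroot5]
        nlinarith
      · nlinarith
    rw [div_mul_eq_mul_div, one_mul, div_le_iff₀ (by positivity)]
    nlinarith [mul_nonneg hy0 (Nat.cast_nonneg (α := ℝ) n)]
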